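/- Let $\mathbb K$ be $\mathbb R$, $\mathbb C$ or $\mathbb H$ and let $n\ge 1$. Regard $\mathbb K^{n+1}$ as a left $\mathbb K$-vector space with the standard Hermitian product $\langle x,y\rangle=\sum_i x_i\overline{y_i}$. Let $\mathbb K\mathbf P^n$ be the projective space of $\mathbb K$-lines of $\mathbb K^{n+1}$, with projection $\pi\colon\mathbb K^{n+1}\setminus\{0\}\to\mathbb K\mathbf P^n$. Let $g$ be the Riemannian metric on $\mathbb K\mathbf P^n$ for which the restriction of $\pi$ to the unit sphere of $\mathbb K^{n+1}$ is a Riemannian submersion (the Fubini–Study metric, resp. the round metric if $\mathbb K=\mathbb R$), and equip $\mathbb K\mathbf P^n$ with the metric $c\,g$ for some constant $c>0$. For $r>0$ let $$T_r\mathbb K\mathbf P^n=\{u\in T\mathbb K\mathbf P^n : c\,g(u,u)=r^2\}$$ be the tangent sphere bundle of radius $r$. Let $V_2(\mathbb K^{n+1})$ be the Stiefel manifold of pairs $(x,y)$ of vectors of $\mathbb K^{n+1}$ with $\|x\|=\|y\|=1$ and $\langle x,y\rangle=0$, and let the projective Stiefel manifold $W_2(\mathbb K^{n+1})$ be the quotient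 manifold of $V_2(\mathbb K^{n+1})$ by the free action $q\cdot(x,y)=(qx,qy)$ of the group $S=\{q\in\mathbb K: |q|=1\}$. Then $T_r\mathbb K\mathbf P^n$ is naturally diffeomorphic to $W_2(\mathbb K^{n+1})$: there is a $C^\infty$ diffeomorphism $$\Phi\colon T_r\mathbb K\mathbf P^n\to W_2(\mathbb K^{n+1})\quad\text{with}\quad \Phi^{-1}\big([x,y]\big)=\frac{r}{\sqrt c}\,d\pi_x(y)\in T_{\pi(x)}\mathbb K\mathbf P^n\quad\text{for all }(x,y)\in V_2(\mathbb K^{n+1}).$$ -/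

import Mathlib

open scoped Manifold ContDiff Quaternion RealInnerProductSpace LinearAlgebra.Projectivization

noncomputable section

/-- The properties shared by `ℝ`, `ℂ` and `ℍ` (with their usual norm, real inner product and
conjugation) which are used to set up the geometry of projective spaces uniformly. -/
class HermitianScalars (K : Type*) [NormedDivisionRing K] [InnerProductSpace ℝ K]
    [StarRing K] : Prop where
  smul_mul : ∀ (t : ℝ) (a b : K), (t • a) * b = t • (a * b)
  mul_smul : ∀ (t : ℝ) (a b : K), a * (t • b) = t • (a * b)
  star_smul : ∀ (t : ℝ) (a : K), star (t • a) = t • star a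
  mul_star_self : ∀ a : K, a * star a = (‖a‖ ^ 2) • (1 : K)
  finiteDimensional : FiniteDimensional ℝ K

instance : HermitianScalars ℝ where
  smul_mul t a b := by simp [mul_assoc]
  mul_smul t a b := by simp [mul_left_comm]
  star_smul t a := by simp
  mul_star_self a := by simp [pow_two]
  finiteDimensional := inferInstance

instance : HermitianScalars ℂ where
  smul_mul t a b := smul_mul_assoc t a b
  mul_smul t a b := mul_smul_comm t a b
  star_smul t a := by simp
  mul_star_self a := by
    have := Complex.mul_conj a
    simp only [Complex.star_def, this, Complex.normSq_eq_norm_sq]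
    simp
  finiteDimensional := inferInstance

instance : HermitianScalars ℍ[ℝ] where
  smul_mul t a b := smul_mul_assoc t a b
  mul_smul t a b := mul_smul_comm t a b
  star_smul t a := by simp
  mul_star_self a := by
    rw [Quaternion.self_mul_star, Quaternion.normSq_eq_norm_mul_self, pow_two,
      Algebra.smul_def, mul_one]
    rfl
  finiteDimensional := inferInstance

section Spheres

variable {E : Type*} [NormedAddCommGroup E] [InnerProductSpace ℝ E]

instance finrank_eq_pred_add_one [FiniteDimensional ℝ E] [Nontrivial E] :
    Fact (Module.finrank ℝ E = (Module.finrank ℝ E - 1) + 1) :=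
  ⟨(Nat.succ_pred_eq_of_pos Module.finrank_pos).symm⟩

variable (E) in
/-- The model space of the unit sphere of `E`. -/
abbrev SphereModel : Type := EuclideanSpace ℝ (Fin (Module.finrank ℝ E - 1))

/-- The direction `w / ‖w‖` of a nonzero vector. -/
def unitDir [Nontrivial E] (w : E) : Metric.sphere (0 : E) 1 :=
  open Classical in
  if h : w ≠ 0 then ⟨‖w‖⁻¹ • w, by simp [norm_smul, h]⟩
  else ⟨_, (NormedSpace.sphere_nonempty (x := (0 : E)).2 zero_le_one).some_mem⟩

variable [Nontrivial E]

lemma coe_unitDir {w : E} (h : w ≠ 0) : (unitDir w : E) = ‖w‖⁻¹ • w := by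
  simp [unitDir, h]

lemma unitDir_smul {t : ℝ} (ht : 0 < t) (w : E) : unitDir (t • w) = unitDir w := by
  by_cases h : w = 0
  · simp [h]
  · apply Subtype.ext
    rw [coe_unitDir h, coe_unitDir (smul_ne_zero ht.ne' h), norm_smul, Real.norm_of_nonneg ht.le,
      smul_smul]
    congr 1
    field_simp

lemma unitDir_coe (s : Metric.sphere (0 : E) 1) : unitDir (s : E) = s := by
  apply Subtype.ext
  rw [coe_unitDir (ne_zero_of_mem_unit_sphere s)]
  simp

lemma contMDiffAt_unitDir [FiniteDimensional ℝ E] {w : E} (hw : w ≠ 0) :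
    ContMDiffAt 𝓘(ℝ, E) (𝓡 (Module.finrank ℝ E - 1)) ∞ (unitDir (E := E)) w := by
  let U : TopologicalSpace.Opens E := ⟨{0}ᶜ, isOpen_compl_singleton⟩
  have hf : ContMDiff 𝓘(ℝ, E) 𝓘(ℝ, E) ∞ (fun x : U => ‖(x : E)‖⁻¹ • (x : E)) := by
    intro x
    have hx : (x : E) ≠ 0 := x.2
    have : ContDiffAt ℝ ∞ (fun y : E => ‖y‖⁻¹ • y) x :=
      ((contDiffAt_norm ℝ hx).inv (norm_ne_zero_iff.2 hx)).smul contDiffAt_id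
    exact this.contMDiffAt.comp x (contMDiff_subtype_val x)
  have hs : ∀ x : U, ‖(x : E)‖⁻¹ • (x : E) ∈ Metric.sphere (0 : E) 1 := by
    intro x
    have hx : (x : E) ≠ 0 := x.2
    simp [norm_smul, hx]
  have := ContMDiff.codRestrict_sphere (n := Module.finrank ℝ E - 1) hf hs
  have h2 := this ⟨w, hw⟩
  refine (contMDiffAt_subtype_iff (x := (⟨w, hw⟩ : U))).1 ?_
  refine h2.congr_of_eventuallyEq (Filter.Eventually.of_forall fun x => ?_)
  exact Subtype.ext (coe_unitDir x.2)

end Spheres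

section Comp

variable {E H : Type*} [NormedAddCommGroup E] [NormedSpace ℝ E] [TopologicalSpace H]
  (I : ModelWithCorners ℝ E H) (Y X : Type*) [TopologicalSpace Y] [ChartedSpace H Y]
  [IsManifold I ∞ Y] [TopologicalSpace X] [ChartedSpace Y X]

/-- A space locally modelled on a manifold, with smooth coordinate changes, is a manifold. -/
lemma isManifold_comp
    (h : ∀ e ∈ atlas Y X, ∀ e' ∈ atlas Y X, ContMDiffOn I I ∞ (e.symm ≫ₕ e') (e.symm ≫ₕ e').source) :
    @IsManifold ℝ _ E _ _ H _ I ∞ X _ (ChartedSpace.comp H Y X) := by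
  let := ChartedSpace.comp H Y X
  refine isManifold_of_contDiffOn _ _ _ ?_
  rintro _ _ ⟨e, he, c, hc, rfl⟩ ⟨e', he', c', hc', rfl⟩
  have h1 := contMDiffOn_of_mem_maximalAtlas (I := I) (n := ∞)
    (IsManifold.subset_maximalAtlas hc')
  have h2 := contMDiffOn_symm_of_mem_maximalAtlas (I := I) (n := ∞)
    (IsManifold.subset_maximalAtlas hc)
  have h3 := (h1.comp' (h e he e' he')).comp' h2
  intro u hu
  have h4 := (contMDiffOn_iff.1 h3).2 (I.symm u) (I.symm u) u
  simp only [chartAt_self_eq, mfld_simps] at h4 hu ⊢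
  refine ContDiffWithinAt.mono (h4 ?_ ?_ ?_ ?_ ?_) ?_
  iterate 5 tauto
  · intro v hv
    simp only [mfld_simps] at hv ⊢
    tauto

end Comp

section TangentSphere

set_option linter.unusedSectionVars false

open Bundle

variable {E : Type*} [NormedAddCommGroup E] [InnerProductSpace ℝ E]

lemma contMDiff_toModelProd : ContMDiff (M := E × E) (M' := ModelProd E E)
    (𝓘(ℝ, E).prod 𝓘(ℝ, E)) (𝓘(ℝ, E).prod 𝓘(ℝ, E)) ∞ (fun q => q) := by
  convert! contMDiff_id (M := ModelProd E E) (I := 𝓘(ℝ, E).prod 𝓘(ℝ, E))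
  exact chartedSpaceSelf_prod

lemma contMDiff_ofModelProd : ContMDiff (M := ModelProd E E) (M' := E × E)
    (𝓘(ℝ, E).prod 𝓘(ℝ, E)) (𝓘(ℝ, E).prod 𝓘(ℝ, E)) ∞ (fun q => q) := by
  convert! contMDiff_id (M := ModelProd E E) (I := 𝓘(ℝ, E).prod 𝓘(ℝ, E))
  exact chartedSpaceSelf_prod

variable {M : Type*} [TopologicalSpace M] [ChartedSpace E M] [IsManifold 𝓘(ℝ, E) ∞ M]

/-- A smooth Riemannian metric on a manifold modelled on `E`. -/
abbrev RiemMetric (E : Type*) [NormedAddCommGroup E] [InnerProductSpace ℝ E]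
    (M : Type*) [TopologicalSpace M] [ChartedSpace E M] [IsManifold 𝓘(ℝ, E) ∞ M] : Type _ :=
  ContMDiffRiemannianMetric 𝓘(ℝ, E) ∞ E (fun x : M => TangentSpace 𝓘(ℝ, E) x)

/-- The squared length of a tangent vector. -/
def RiemMetric.normSq (g : RiemMetric E M) (u : TangentBundle 𝓘(ℝ, E) M) : ℝ :=
  g.inner u.proj u.2 u.2

/-- The tangent sphere bundle `T_r M` of radius `r > 0` of a Riemannian manifold `(M, g)`, with the
topology induced by that of `T M`. -/
def TangentSphereBundle (g : RiemMetric E M) {r : ℝ} (_hr : 0 < r) : Type _ :=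
  {u : TangentBundle 𝓘(ℝ, E) M // g.normSq u = r ^ 2}

variable (g : RiemMetric E M) {r : ℝ} (hr : 0 < r)

instance : TopologicalSpace (TangentSphereBundle g hr) := instTopologicalSpaceSubtype

/-- Scalar multiplication in the fibers of `T M`. -/
def tangentSMul (t : ℝ) (u : TangentBundle 𝓘(ℝ, E) M) : TangentBundle 𝓘(ℝ, E) M :=
  ⟨u.proj, t • u.2⟩

lemma normSq_tangentSMul (t : ℝ) (u : TangentBundle 𝓘(ℝ, E) M) :
    g.normSq (tangentSMul t u) = t ^ 2 * g.normSq u := by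
  change g.inner u.proj (t • u.2) (t • u.2) = t ^ 2 * g.inner u.proj u.2 u.2
  rw [(g.inner u.proj).map_smul t u.2, smul_apply,
    (g.inner u.proj u.2).map_smul t u.2, smul_eq_mul, smul_eq_mul]
  ring

lemma normSq_pos {u : TangentBundle 𝓘(ℝ, E) M} (hu : u.2 ≠ 0) : 0 < g.normSq u :=
  g.pos _ _ hu

lemma contMDiff_normSq :
    ContMDiff (𝓘(ℝ, E).prod 𝓘(ℝ, E)) 𝓘(ℝ) ∞ (RiemMetric.normSq g) := by
  intro u
  have h1 : ContMDiffAt (𝓘(ℝ, E).prod 𝓘(ℝ, E)) 𝓘(ℝ, E) ∞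
    (fun u : TangentBundle 𝓘(ℝ, E) M => u.proj) u := contMDiff_proj _ u
  have : ContMDiffAt (𝓘(ℝ, E).prod 𝓘(ℝ, E)) (𝓘(ℝ, E).prod 𝓘(ℝ)) ∞
      (fun u : TangentBundle 𝓘(ℝ, E) M => TotalSpace.mk' ℝ (E := Bundle.Trivial M ℝ) u.proj
        (g.inner u.proj u.2 u.2)) u := by
    apply ContMDiffAt.clm_bundle_apply₂ (F₁ := E) (F₂ := E)
    · exact ContMDiffAt.comp u g.contMDiff.contMDiffAt h1
    · exact contMDiffAt_id
    · exact contMDiffAt_id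
  simp only [contMDiffAt_totalSpace] at this
  exact this.2

/-- The chart of `T M` induced by the chart of `M` at `p`. -/
def tangentChart (p : M) : OpenPartialHomeomorph (TangentBundle 𝓘(ℝ, E) M) (ModelProd E E) :=
  chartAt (ModelProd E E) (⟨p, 0⟩ : TangentBundle 𝓘(ℝ, E) M)

lemma mem_tangentChart_source (p : M) (u : TangentBundle 𝓘(ℝ, E) M) :
    u ∈ (tangentChart p).source ↔ u.proj ∈ (chartAt E p).source :=
  TangentBundle.mem_chart_source_iff _ _

lemma mem_tangentChart_target (p : M) (q : ModelProd E E) :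
    q ∈ (tangentChart p : OpenPartialHomeomorph (TangentBundle 𝓘(ℝ, E) M) _).target ↔
      q.1 ∈ (chartAt E p).target :=
  TangentBundle.mem_chart_target_iff _ _

lemma tangentChart_smul (p : M) (t : ℝ) {u : TangentBundle 𝓘(ℝ, E) M}
    (hu : u ∈ (tangentChart p).source) :
    tangentChart p (tangentSMul t u) = ((tangentChart p u).1, t • (tangentChart p u).2) := by
  have hb : u.proj ∈ (trivializationAt E (TangentSpace 𝓘(ℝ, E)) p).baseSet :=
    (mem_tangentChart_source p u).1 hu
  refine Prod.ext rfl ?_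
  exact ((trivializationAt E (TangentSpace 𝓘(ℝ, E)) p).linear ℝ hb).map_smul t u.2

lemma tangentChart_symm_smul (p : M) (t : ℝ) {q : ModelProd E E}
    (hq : q.1 ∈ (chartAt E p).target) :
    (tangentChart p).symm (q.1, t • q.2) =
      tangentSMul t ((tangentChart p).symm q : TangentBundle 𝓘(ℝ, E) M) := by
  have hq' := (mem_tangentChart_target p q).2 hq
  have h1 := (tangentChart p).map_target hq'
  have h2 : tangentSMul t ((tangentChart p).symm q : TangentBundle 𝓘(ℝ, E) M) ∈
      (tangentChart p).source :=
    (mem_tangentChart_source _ _).2 ((mem_tangentChart_source _ _).1 h1)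
  rw [← (tangentChart p).left_inv h2, tangentChart_smul p t h1, (tangentChart p).right_inv hq']

lemma tangentChart_snd_ne_zero (p : M) {u : TangentBundle 𝓘(ℝ, E) M}
    (hu : u ∈ (tangentChart p).source) (h : u.2 ≠ 0) : (tangentChart p u).2 ≠ 0 := by
  intro h0
  have h1 := (tangentChart p).map_source hu
  have h2 := tangentChart_symm_smul p 0 ((mem_tangentChart_target p _).1 h1)
  rw [zero_smul, ← h0] at h2
  have h3 : u = tangentSMul 0 u := by
    conv_lhs => rw [← (tangentChart p).left_inv hu]
    conv_rhs => rw [← (tangentChart p).left_inv hu]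
    exact h2
  apply h
  rw [h3]
  exact zero_smul ℝ _

lemma tangentChart_symm_snd_ne_zero (p : M) {q : ModelProd E E}
    (hq : q.1 ∈ (chartAt E p).target) (h : q.2 ≠ 0) :
    ((tangentChart p).symm q : TangentBundle 𝓘(ℝ, E) M).2 ≠ 0 := by
  intro h0
  have hq' := (mem_tangentChart_target p q).2 hq
  have h1 := (tangentChart p).map_target hq'
  have h2 := tangentChart_smul p 0 h1
  have h3 : tangentSMul 0 ((tangentChart p).symm q : TangentBundle 𝓘(ℝ, E) M) =
      (tangentChart p).symm q := by
    have : (0 : ℝ) • ((tangentChart p).symm q : TangentBundle 𝓘(ℝ, E) M).2 =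
      ((tangentChart p).symm q : TangentBundle 𝓘(ℝ, E) M).2 := by rw [h0, smul_zero]
    unfold tangentSMul
    rw [this]
  rw [h3, (tangentChart p).right_inv hq', zero_smul] at h2
  exact h (congrArg Prod.snd h2)

/-- The polar rescaling of a chart of `T M`: to `(e, s)` corresponds the vector of length `r` which
is a positive multiple of the vector with coordinates `(e, s)`. -/
def tangentPolar (r : ℝ) (p : M) (q : E × Metric.sphere (0 : E) 1) : TangentBundle 𝓘(ℝ, E) M :=
  (tangentChart p).symm
    (q.1, (r / √(g.normSq ((tangentChart p).symm (q.1, (q.2 : E))))) • (q.2 : E))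

lemma tangentPolar_eq (r : ℝ) {p : M} {q : E × Metric.sphere (0 : E) 1}
    (hq : q.1 ∈ (chartAt E p).target) :
    tangentPolar g r p q = tangentSMul (r / √(g.normSq ((tangentChart p).symm (q.1, (q.2 : E)))))
      ((tangentChart p).symm (q.1, (q.2 : E))) :=
  tangentChart_symm_smul p _ (q := (q.1, (q.2 : E))) hq

lemma normSq_symm_pos {p : M} {q : E × Metric.sphere (0 : E) 1}
    (hq : q.1 ∈ (chartAt E p).target) :
    0 < g.normSq ((tangentChart p).symm (q.1, (q.2 : E))) :=
  normSq_pos g (tangentChart_symm_snd_ne_zero p (q := (q.1, (q.2 : E))) hq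
    (ne_zero_of_mem_unit_sphere q.2))

lemma normSq_tangentPolar (r : ℝ) {p : M} {q : E × Metric.sphere (0 : E) 1}
    (hq : q.1 ∈ (chartAt E p).target) : g.normSq (tangentPolar g r p q) = r ^ 2 := by
  have h := normSq_symm_pos g hq
  rw [tangentPolar_eq g r hq, normSq_tangentSMul, div_pow, Real.sq_sqrt h.le,
    div_mul_cancel₀ _ h.ne']

lemma contMDiffOn_tangentPolar [FiniteDimensional ℝ E] [Nontrivial E] (r : ℝ) (p : M) :
    ContMDiffOn (𝓘(ℝ, E).prod (𝓡 (Module.finrank ℝ E - 1))) (𝓘(ℝ, E).prod 𝓘(ℝ, E)) ∞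
      (tangentPolar g r p) ((chartAt E p).target ×ˢ Set.univ) := by
  have h1 : ContMDiffOn (𝓘(ℝ, E).prod 𝓘(ℝ, E)) (𝓘(ℝ, E).prod 𝓘(ℝ, E)) ∞
      (tangentChart p : OpenPartialHomeomorph (TangentBundle 𝓘(ℝ, E) M) _).symm
      (tangentChart p).target :=
    contMDiffOn_chart_symm (x := (⟨p, 0⟩ : TangentBundle 𝓘(ℝ, E) M))
  have h2 : ContMDiff (𝓘(ℝ, E).prod (𝓡 (Module.finrank ℝ E - 1))) 𝓘(ℝ, E) ∞
      (fun q : E × Metric.sphere (0 : E) 1 => (q.2 : E)) :=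
    contMDiff_coe_sphere.comp contMDiff_snd
  have h3 : ContMDiffOn (𝓘(ℝ, E).prod (𝓡 (Module.finrank ℝ E - 1))) (𝓘(ℝ, E).prod 𝓘(ℝ, E)) ∞
      (fun q : E × Metric.sphere (0 : E) 1 => (tangentChart p).symm (q.1, (q.2 : E)))
      ((chartAt E p).target ×ˢ Set.univ) :=
    h1.comp (contMDiff_toModelProd.comp (contMDiff_fst.prodMk h2)).contMDiffOn
      fun q hq => (mem_tangentChart_target p _).2 hq.1
  have h4 : ContMDiffOn (𝓘(ℝ, E).prod (𝓡 (Module.finrank ℝ E - 1))) 𝓘(ℝ) ∞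
      (fun q : E × Metric.sphere (0 : E) 1 =>
        r / √(g.normSq ((tangentChart p).symm (q.1, (q.2 : E)))))
      ((chartAt E p).target ×ˢ Set.univ) := by
    intro q hq
    have h := normSq_symm_pos g (q := q) hq.1
    have h5 : ContDiffAt ℝ ∞ (fun t : ℝ => r / √t)
        (g.normSq ((tangentChart p).symm (q.1, (q.2 : E)))) :=
      contDiffAt_const.div (contDiffAt_id.sqrt h.ne') (Real.sqrt_ne_zero'.2 h)
    exact ContMDiffAt.comp_contMDiffWithinAt (g := fun t : ℝ => r / √t) q h5.contMDiffAt
      (ContMDiffAt.comp_contMDiffWithinAt q (contMDiff_normSq g _) (h3 q hq))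
  exact h1.comp (contMDiff_toModelProd.comp_contMDiffOn
    (contMDiff_fst.contMDiffOn.prodMk (h4.smul h2.contMDiffOn)))
    fun q hq => (mem_tangentChart_target p _).2 hq.1

variable [FiniteDimensional ℝ E] [Nontrivial E]

/-- The coordinates `u ↦ (e, w / ‖w‖)` of nonzero tangent vectors, where `(e, w)` are the
coordinates of `u` in the chart of `T M` induced by the chart of `M` at `p`. -/
def tangentDir (p : M) (u : TangentBundle 𝓘(ℝ, E) M) : E × Metric.sphere (0 : E) 1 :=
  ((tangentChart p u).1, unitDir (tangentChart p u).2)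

lemma contMDiffAt_tangentDir {p : M} {u : TangentBundle 𝓘(ℝ, E) M}
    (hu : u.proj ∈ (chartAt E p).source) (h : u.2 ≠ 0) :
    ContMDiffAt (𝓘(ℝ, E).prod 𝓘(ℝ, E)) (𝓘(ℝ, E).prod (𝓡 (Module.finrank ℝ E - 1))) ∞
      (tangentDir p) u := by
  have hu' := (mem_tangentChart_source p u).2 hu
  have h1 : ContMDiffAt (𝓘(ℝ, E).prod 𝓘(ℝ, E)) (𝓘(ℝ, E).prod 𝓘(ℝ, E)) ∞
      (tangentChart p : OpenPartialHomeomorph (TangentBundle 𝓘(ℝ, E) M) _) u :=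
    (contMDiffOn_chart (x := (⟨p, 0⟩ : TangentBundle 𝓘(ℝ, E) M))).contMDiffAt
      ((tangentChart p).open_source.mem_nhds hu')
  have h2 := (contMDiff_ofModelProd (E := E) (tangentChart p u)).comp u h1
  have h3 := contMDiffAt_unitDir (tangentChart_snd_ne_zero p hu' h)
  exact (contMDiffAt_fst.comp u h2).prodMk (h3.comp u (contMDiffAt_snd.comp u h2))

lemma TangentSphereBundle.snd_ne_zero (u : TangentSphereBundle g hr) : u.1.2 ≠ 0 := by
  intro h
  have h1 : g.normSq u.1 = r ^ 2 := u.2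
  have h2 : g.normSq u.1 = 0 := by
    unfold RiemMetric.normSq
    rw [h, map_zero]
  rw [h2] at h1
  exact (pow_pos hr 2).ne h1

lemma tangentDir_tangentPolar {r : ℝ} (hr : 0 < r) {p : M} {q : E × Metric.sphere (0 : E) 1}
    (hq : q.1 ∈ (chartAt E p).target) : tangentDir p (tangentPolar g r p q) = q := by
  have h := normSq_symm_pos g hq
  unfold tangentDir tangentPolar
  rw [(tangentChart p).right_inv ((mem_tangentChart_target p _).2 hq)]
  refine Prod.ext rfl ?_
  change unitDir (_ • (q.2 : E)) = q.2
  rw [unitDir_smul (div_pos hr (Real.sqrt_pos.2 h)), unitDir_coe]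

lemma tangentPolar_tangentDir {r : ℝ} (hr : 0 < r) {p : M} {u : TangentBundle 𝓘(ℝ, E) M}
    (hu : u.proj ∈ (chartAt E p).source) (h : g.normSq u = r ^ 2) (h0 : u.2 ≠ 0) :
    tangentPolar g r p (tangentDir p u) = u := by
  have hu' := (mem_tangentChart_source p u).2 hu
  have ht : (tangentChart p u).1 ∈ (chartAt E p).target :=
    (mem_tangentChart_target p _).1 ((tangentChart p).map_source hu')
  have hw := tangentChart_snd_ne_zero p hu' h0
  have hw' : 0 < ‖(tangentChart p u).2‖⁻¹ := inv_pos.2 (norm_pos_iff.2 hw)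
  rw [tangentPolar_eq g r (q := tangentDir p u) ht]
  have h1 : (tangentChart p).symm ((tangentDir p u).1, ((tangentDir p u).2 : E)) =
      tangentSMul ‖(tangentChart p u).2‖⁻¹ u := by
    have := tangentChart_symm_smul p ‖(tangentChart p u).2‖⁻¹ ht
    rw [(tangentChart p).left_inv hu'] at this
    rw [← this]
    unfold tangentDir
    rw [coe_unitDir hw]
  rw [h1, normSq_tangentSMul, h, ← mul_pow, Real.sqrt_sq (by positivity)]
  have h2 : r / (‖(tangentChart p u).2‖⁻¹ * r) * ‖(tangentChart p u).2‖⁻¹ = 1 := by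
    field_simp
  have h3 : (r / (‖(tangentChart p u).2‖⁻¹ * r)) • ‖(tangentChart p u).2‖⁻¹ • u.2 = u.2 := by
    rw [smul_smul, h2, one_smul]
  unfold tangentSMul
  rw [h3]

/-- `tangentPolar` with values in `T_r M` (extended arbitrarily outside of the chart). -/
def tangentSphereParam (p : M) (q : E × Metric.sphere (0 : E) 1) : TangentSphereBundle g hr :=
  open Classical in
  if hq : q.1 ∈ (chartAt E p).target then ⟨tangentPolar g r p q, normSq_tangentPolar g r hq⟩
  else ⟨tangentPolar g r p (chartAt E p p, q.2),
    normSq_tangentPolar g r (mem_chart_target E p)⟩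

lemma coe_tangentSphereParam {p : M} {q : E × Metric.sphere (0 : E) 1}
    (hq : q.1 ∈ (chartAt E p).target) :
    (tangentSphereParam g hr p q).1 = tangentPolar g r p q :=
  congrArg Subtype.val (dif_pos hq)

/-- The chart of `T_r M` induced by the chart of `M` at `p`. -/
def tangentSphereChart (p : M) :
    OpenPartialHomeomorph (TangentSphereBundle g hr) (E × Metric.sphere (0 : E) 1) where
  toFun u := tangentDir p u.1
  invFun q := tangentSphereParam g hr p q
  source := {u | u.1.proj ∈ (chartAt E p).source}
  target := (chartAt E p).target ×ˢ Set.univ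
  map_source' u hu := ⟨(chartAt E p).map_source hu, trivial⟩
  map_target' q hq := by
    change (tangentSphereParam g hr p q).1.proj ∈ (chartAt E p).source
    rw [coe_tangentSphereParam g hr hq.1]
    exact (chartAt E p).map_target hq.1
  left_inv' u hu := by
    have hu' : (tangentDir p u.1).1 ∈ (chartAt E p).target := (chartAt E p).map_source hu
    exact Subtype.ext ((coe_tangentSphereParam g hr hu').trans
      (tangentPolar_tangentDir g hr hu u.2 (u.snd_ne_zero g hr)))
  right_inv' q hq := by
    rw [coe_tangentSphereParam g hr hq.1]
    exact tangentDir_tangentPolar g hr hq.1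
  open_source := (chartAt E p).open_source.preimage
    ((FiberBundle.continuous_proj E (TangentSpace 𝓘(ℝ, E))).comp continuous_subtype_val)
  open_target := (chartAt E p).open_target.prod isOpen_univ
  continuousOn_toFun u hu :=
    ((contMDiffAt_tangentDir hu (u.snd_ne_zero g hr)).continuousAt.comp
      continuous_subtype_val.continuousAt).continuousWithinAt
  continuousOn_invFun := by
    refine (Topology.IsInducing.subtypeVal.continuousOn_iff).2 ?_
    exact (contMDiffOn_tangentPolar g r p).continuousOn.congr fun q hq =>
      coe_tangentSphereParam g hr hq.1

/-- `T_r M` is locally modelled on the manifold `E × S(E)`. -/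
@[reducible] def TangentSphereBundle.localProductCharts :
    ChartedSpace (E × Metric.sphere (0 : E) 1) (TangentSphereBundle g hr) where
  atlas := Set.range (tangentSphereChart g hr)
  chartAt u := tangentSphereChart g hr u.1.proj
  mem_chart_source u := mem_chart_source E u.1.proj
  chart_mem_atlas _ := ⟨_, rfl⟩

/-- The manifold structure of `T_r M`. -/
instance TangentSphereBundle.instChartedSpace :
    ChartedSpace (ModelProd E (SphereModel E)) (TangentSphereBundle g hr) :=
  letI := TangentSphereBundle.localProductCharts g hr
  ChartedSpace.comp _ (E × Metric.sphere (0 : E) 1) _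

instance TangentSphereBundle.instIsManifold :
    IsManifold (𝓘(ℝ, E).prod 𝓘(ℝ, SphereModel E)) ∞ (TangentSphereBundle g hr) := by
  let := TangentSphereBundle.localProductCharts g hr
  refine isManifold_comp _ (E × Metric.sphere (0 : E) 1) _ ?_
  rintro _ ⟨p, rfl⟩ _ ⟨p', rfl⟩ q hq
  rw [OpenPartialHomeomorph.trans_source] at hq
  have h1 : q.1 ∈ (chartAt E p).target := hq.1.1
  have h2 : (tangentSphereParam g hr p q).1.proj ∈ (chartAt E p').source := hq.2
  have h3 : (tangentSphereParam g hr p q).1.2 ≠ 0 :=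
    (tangentSphereParam g hr p q).snd_ne_zero g hr
  rw [coe_tangentSphereParam g hr h1] at h2 h3
  have h4 : (chartAt E p).target ×ˢ (Set.univ : Set (Metric.sphere (0 : E) 1)) ∈ nhds q :=
    ((chartAt E p).open_target.prod isOpen_univ).mem_nhds ⟨h1, trivial⟩
  have h5 := (contMDiffAt_tangentDir h2 h3).comp q
    ((contMDiffOn_tangentPolar g r p).contMDiffAt h4)
  refine (h5.congr_of_eventuallyEq ?_).contMDiffWithinAt
  filter_upwards [h4] with q' hq'
  exact congrArg (tangentDir p') (coe_tangentSphereParam g hr hq'.1)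

end TangentSphere
section ProjectiveSpace

variable (K : Type*) [NormedDivisionRing K] [InnerProductSpace ℝ K] [StarRing K]

/-- `K ^ n` with its Euclidean norm; it is a left vector space over `K` and a real inner product
space. -/
abbrev KVec (n : ℕ) : Type _ := PiLp 2 (fun _ : Fin n => K)

/-- The standard Hermitian product of `K ^ n`, linear in the first variable for the left
multiplication by scalars. -/
def hermProd {K : Type*} [NormedDivisionRing K] [StarRing K] {n : ℕ} (x y : KVec K n) : K :=
  ∑ i, x i * star (y i)

/-- The `K`-projective space `K P ^ n`, the space of lines through the origin of `K ^ (n + 1)`. -/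
abbrev KProj (n : ℕ) : Type _ := ℙ K (KVec K (n + 1))

variable {K} {n : ℕ}

set_option linter.unusedSectionVars false

/-- `K P ^ n` has the quotient topology. -/
instance KProj.instTopologicalSpace : TopologicalSpace (KProj K n) :=
  inferInstanceAs (TopologicalSpace (Quotient (projectivizationSetoid K (KVec K (n + 1)))))

/-- The affine coordinates `x ↦ (x_i⁻¹ x_j)_{j ≠ i}`. -/
def affineCoord (i : Fin (n + 1)) (x : KVec K (n + 1)) : KVec K n :=
  WithLp.toLp 2 fun j => (x i)⁻¹ * x (i.succAbove j)

/-- The vector of `K ^ (n + 1)` with `i`-th coordinate `c` and the other ones given by `z`. -/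
def insertCoord (i : Fin (n + 1)) (c : K) (z : KVec K n) : KVec K (n + 1) :=
  WithLp.toLp 2 (i.insertNth (α := fun _ => K) c fun j => z j)

@[simp] lemma insertCoord_same (i : Fin (n + 1)) (c : K) (z : KVec K n) :
    insertCoord i c z i = c := by simp [insertCoord]

@[simp] lemma insertCoord_succAbove (i : Fin (n + 1)) (c : K) (z : KVec K n) (j : Fin n) :
    insertCoord i c z (i.succAbove j) = z j := by simp [insertCoord]

lemma KVec.ext_succAbove (i : Fin (n + 1)) {x y : KVec K (n + 1)} (h : x i = y i)
    (h' : ∀ j, x (i.succAbove j) = y (i.succAbove j)) : x = y := by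
  ext j
  rcases Fin.eq_self_or_eq_succAbove i j with rfl | ⟨k, rfl⟩
  exacts [h, h' k]

lemma insertCoord_one_ne_zero (i : Fin (n + 1)) (z : KVec K n) :
    insertCoord i 1 z ≠ 0 := fun h => by
  have := congrArg (fun x : KVec K (n + 1) => x i) h
  simp at this

@[simp] lemma affineCoord_insertCoord (i : Fin (n + 1)) (z : KVec K n) :
    affineCoord i (insertCoord i 1 z) = z := by
  ext j; simp [affineCoord]

lemma affineCoord_smul (i : Fin (n + 1)) {t : K} (ht : t ≠ 0) (x : KVec K (n + 1)) :
    affineCoord i (t • x) = affineCoord i x := by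
  ext j; simp [affineCoord, mul_assoc, ht]

lemma smul_insertCoord_affineCoord (i : Fin (n + 1)) {x : KVec K (n + 1)} (hx : x i ≠ 0) :
    x i • insertCoord i 1 (affineCoord i x) = x := by
  apply KVec.ext_succAbove i
  · simp
  · intro j; simp [affineCoord, hx]

section Smooth

variable [HermitianScalars K]

/-- The underlying real normed algebra. -/
@[reducible] def HermitianScalars.normedAlgebra : NormedAlgebra ℝ K :=
  { Algebra.ofModule (R := ℝ) (A := K) HermitianScalars.smul_mul
      HermitianScalars.mul_smul with
    norm_smul_le := norm_smul_le }

instance (n : ℕ) : FiniteDimensional ℝ (KVec K n) :=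
  haveI : FiniteDimensional ℝ K := HermitianScalars.finiteDimensional
  inferInstance

instance HermitianScalars.completeSpace : CompleteSpace K :=
  haveI : FiniteDimensional ℝ K := HermitianScalars.finiteDimensional
  FiniteDimensional.complete ℝ K

/-- The conjugation of `K` as a real linear map. -/
def HermitianScalars.starL : K →L[ℝ] K :=
  haveI : FiniteDimensional ℝ K := HermitianScalars.finiteDimensional
  LinearMap.toContinuousLinearMap
    { toFun := star, map_add' := star_add, map_smul' := HermitianScalars.star_smul }

variable {E : Type*} [NormedAddCommGroup E] [NormedSpace ℝ E] {m : WithTop ℕ∞}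
  {f g : E → K} {x : E} {s : Set E}

lemma ContDiffAt.scalarMul (hf : ContDiffAt ℝ m f x) (hg : ContDiffAt ℝ m g x) :
    ContDiffAt ℝ m (fun y => f y * g y) x :=
  letI := HermitianScalars.normedAlgebra (K := K)
  ContDiffAt.mul hf hg

lemma HermitianScalars.contDiffAt_inv {a : K} (ha : a ≠ 0) :
    ContDiffAt ℝ m (fun y : K => y⁻¹) a := by
  let := HermitianScalars.normedAlgebra (K := K)
  simpa only [Ring.inverse_eq_inv'] using! contDiffAt_ringInverse ℝ (Units.mk0 a ha)

lemma ContDiffAt.scalarInv (hf : ContDiffAt ℝ m f x) (hx : f x ≠ 0) :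
    ContDiffAt ℝ m (fun y => (f y)⁻¹) x :=
  ContDiffAt.comp x (HermitianScalars.contDiffAt_inv hx) hf

lemma ContDiffAt.scalarStar (hf : ContDiffAt ℝ m f x) : ContDiffAt ℝ m (fun y => star (f y)) x :=
  (HermitianScalars.starL (K := K)).contDiff.contDiffAt.comp x hf

lemma contDiff_coord (i : Fin n) : ContDiff ℝ m (fun x : KVec K n => x i) :=
  contDiff_piLp_apply (p := 2)

lemma ContDiffAt.coord {f : E → KVec K n} (hf : ContDiffAt ℝ m f x) (i : Fin n) :
    ContDiffAt ℝ m (fun y => f y i) x :=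
  (contDiff_coord i).contDiffAt.comp x hf

lemma ContDiffAt.kvecSMul {g : E → KVec K n} (hf : ContDiffAt ℝ m f x)
    (hg : ContDiffAt ℝ m g x) : ContDiffAt ℝ m (fun y => f y • g y) x :=
  contDiffAt_piLp (p := 2) |>.2 fun i => hf.scalarMul (hg.coord i)

lemma ContDiffAt.hermProd {f g : E → KVec K n} (hf : ContDiffAt ℝ m f x)
    (hg : ContDiffAt ℝ m g x) : ContDiffAt ℝ m (fun y => hermProd (f y) (g y)) x :=
  ContDiffAt.sum fun i _ => (hf.coord i).scalarMul (hg.coord i).scalarStar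

lemma ContDiffAt.affineCoord {f : E → KVec K (n + 1)} (i : Fin (n + 1))
    (hf : ContDiffAt ℝ m f x) (hx : f x i ≠ 0) :
    ContDiffAt ℝ m (fun y => affineCoord i (f y)) x :=
  contDiffAt_piLp (p := 2) |>.2 fun j => ((hf.coord i).scalarInv hx).scalarMul (hf.coord (i.succAbove j))

lemma ContDiffAt.insertCoord {g : E → KVec K n} (i : Fin (n + 1)) (hf : ContDiffAt ℝ m f x)
    (hg : ContDiffAt ℝ m g x) : ContDiffAt ℝ m (fun y => insertCoord i (f y) (g y)) x := by
  refine contDiffAt_piLp (p := 2) |>.2 fun j => ?_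
  rcases Fin.eq_self_or_eq_succAbove i j with rfl | ⟨k, rfl⟩
  · simpa using hf
  · simpa using hg.coord k

end Smooth

/-- The projection `π : K ^ (n + 1) ∖ {0} → K P ^ n`, extended arbitrarily to the origin. -/
def toProj (x : KVec K (n + 1)) : KProj K n :=
  open Classical in
  if h : x ≠ 0 then Projectivization.mk K x h
  else Projectivization.mk K (insertCoord 0 1 0) (insertCoord_one_ne_zero 0 0)

lemma toProj_of_ne_zero {x : KVec K (n + 1)} (hx : x ≠ 0) :
    toProj x = Projectivization.mk K x hx := dif_pos hx

lemma ne_zero_of_coord {x : KVec K (n + 1)} {i : Fin (n + 1)} (hx : x i ≠ 0) : x ≠ 0 := by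
  rintro rfl; simp at hx

lemma toProj_smul {t : K} (ht : t ≠ 0) {x : KVec K (n + 1)} (hx : x ≠ 0) :
    toProj (t • x) = toProj x := by
  rw [toProj_of_ne_zero hx, toProj_of_ne_zero (smul_ne_zero ht hx)]
  exact (Projectivization.mk_eq_mk_iff' K _ _ _ _).2 ⟨t, rfl⟩

lemma continuousOn_toProj : ContinuousOn (toProj (K := K) (n := n)) {0}ᶜ := by
  rw [continuousOn_iff_continuous_domRestrict]
  have : Set.domRestrict {0}ᶜ (toProj (K := K) (n := n)) =
      fun x => (Quotient.mk'' ⟨x.1, x.2⟩ : Quotient (projectivizationSetoid K _)) := by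
    funext x
    exact toProj_of_ne_zero x.2
  rw [this]
  exact continuous_quot_mk.comp (by fun_prop)

/-- The affine chart `[x] ↦ (x_i⁻¹ x_j)_{j ≠ i}` of `K P ^ n`, defined where `x_i ≠ 0`. -/
def affineChart [HermitianScalars K] (i : Fin (n + 1)) :
    OpenPartialHomeomorph (KProj K n) (KVec K n) where
  toFun := Projectivization.lift (fun v => affineCoord i v.1) (by
    rintro ⟨a, ha⟩ ⟨b, hb⟩ t rfl
    exact affineCoord_smul i (left_ne_zero_of_smul ha) b)
  invFun z := toProj (insertCoord i 1 z)
  source := {p | Projectivization.lift (fun v : {w : KVec K (n + 1) // w ≠ 0} => v.1 i ≠ 0) (by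
    rintro ⟨a, ha⟩ ⟨b, hb⟩ t rfl
    simp [left_ne_zero_of_smul ha]) p}
  target := Set.univ
  map_source' _ _ := trivial
  map_target' z _ := by
    rw [toProj_of_ne_zero (insertCoord_one_ne_zero i z)]
    simp
  left_inv' := by
    intro p hp
    induction p using Projectivization.ind with
    | h v hv =>
      simp only [Projectivization.lift_mk, Set.mem_ofPred_eq] at hp ⊢
      rw [← toProj_of_ne_zero hv]
      conv_rhs => rw [← smul_insertCoord_affineCoord (x := v) i hp]
      rw [toProj_smul hp (insertCoord_one_ne_zero i _)]
  right_inv' z _ := by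
    rw [toProj_of_ne_zero (insertCoord_one_ne_zero i z)]
    simp
  open_source := by
    refine isOpen_coinduced.2 ?_
    exact isOpen_ne_fun
      (((contDiff_coord (m := 0) i).continuous).comp continuous_subtype_val) continuous_const
  open_target := isOpen_univ
  continuousOn_toFun := by
    have hq : Topology.IsQuotientMap
        (Quotient.mk'' : _ → Quotient (projectivizationSetoid K (KVec K (n + 1)))) :=
      isQuotientMap_quot_mk
    refine (hq.continuousOn_isOpen_iff ?_).2 ?_
    · refine isOpen_coinduced.2 ?_
      exact isOpen_ne_fun
        (((contDiff_coord (m := 0) i).continuous).comp continuous_subtype_val) continuous_const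
    · intro v hv
      have := (ContDiffAt.affineCoord (m := 0) i (contDiffAt_id (x := v.1)) hv).continuousAt
      exact (this.comp continuous_subtype_val.continuousAt).continuousWithinAt
  continuousOn_invFun := by
    refine continuousOn_toProj.comp (Continuous.continuousOn ?_) ?_
    · refine (contDiff_iff_contDiffAt.2 fun z => ?_ : ContDiff ℝ 0 _).continuous
      exact ContDiffAt.insertCoord i contDiffAt_const contDiffAt_id
    · intro z _
      exact insertCoord_one_ne_zero i z

lemma affineChart_toProj [HermitianScalars K] (i : Fin (n + 1)) {x : KVec K (n + 1)}
    (hx : x ≠ 0) : affineChart i (toProj x) = affineCoord i x := by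
  rw [toProj_of_ne_zero hx]; rfl

lemma toProj_mem_affineChart_source [HermitianScalars K] (i : Fin (n + 1))
    {x : KVec K (n + 1)} (hx : x ≠ 0) : toProj x ∈ (affineChart i).source ↔ x i ≠ 0 := by
  rw [toProj_of_ne_zero hx]; rfl

lemma affineChart_symm_apply [HermitianScalars K] (i : Fin (n + 1)) (z : KVec K n) :
    (affineChart i).symm z = toProj (insertCoord i 1 z) := rfl

lemma toProj_surjective (p : KProj K n) : ∃ x : KVec K (n + 1), x ≠ 0 ∧ toProj x = p := by
  induction p using Projectivization.ind with
  | h v hv => exact ⟨v, hv, toProj_of_ne_zero hv⟩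

lemma exists_mem_affineChart_source [HermitianScalars K] (p : KProj K n) :
    ∃ i, p ∈ (affineChart i).source := by
  obtain ⟨x, hx, rfl⟩ := toProj_surjective p
  by_contra! h
  refine hx ?_
  ext i
  by_contra h'
  exact h i ((toProj_mem_affineChart_source i hx).2 h')

instance KProj.instChartedSpace [HermitianScalars K] : ChartedSpace (KVec K n) (KProj K n) where
  atlas := Set.range affineChart
  chartAt p := affineChart (exists_mem_affineChart_source p).choose
  mem_chart_source p := (exists_mem_affineChart_source p).choose_spec
  chart_mem_atlas _ := ⟨_, rfl⟩

instance KProj.instIsManifold [HermitianScalars K] :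
    IsManifold 𝓘(ℝ, KVec K n) ∞ (KProj K n) := by
  refine isManifold_of_contDiffOn _ _ _ ?_
  rintro _ _ ⟨i, rfl⟩ ⟨j, rfl⟩
  simp only [modelWithCornersSelf_coe, modelWithCornersSelf_coe_symm, Function.id_comp,
    Function.comp_id, Set.range_id, Set.inter_univ, Set.preimage_id]
  intro z hz
  rw [OpenPartialHomeomorph.trans_source] at hz
  have h : (affineChart i).symm z ∈ (affineChart j).source := hz.2
  rw [affineChart_symm_apply, toProj_mem_affineChart_source j (insertCoord_one_ne_zero i z)] at h
  refine ContDiffAt.contDiffWithinAt ?_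
  have : ContDiffAt ℝ ∞ (fun y : KVec K n => affineCoord j (insertCoord i 1 y)) z :=
    ContDiffAt.affineCoord j (ContDiffAt.insertCoord i contDiffAt_const contDiffAt_id) h
  refine this.congr_of_eventuallyEq (Filter.Eventually.of_forall fun y => ?_)
  exact affineChart_toProj j (insertCoord_one_ne_zero i y)

section Stiefel

variable (K) (n) in
/-- The Stiefel manifold `V_2(K ^ n)` of orthonormal `2`-frames of `K ^ n`. -/
def Stiefel : Type _ :=
  {f : KVec K n × KVec K n // ‖f.1‖ = 1 ∧ ‖f.2‖ = 1 ∧ hermProd f.1 f.2 = 0}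

instance : TopologicalSpace (Stiefel K n) := instTopologicalSpaceSubtype

lemma hermProd_smul_smul (a b : K) (x y : KVec K n) :
    hermProd (a • x) (b • y) = a * hermProd x y * star b := by
  simp [hermProd, Finset.mul_sum, Finset.sum_mul, mul_assoc]

lemma norm_kvec_smul (a : K) (x : KVec K n) : ‖a • x‖ = ‖a‖ * ‖x‖ := norm_smul a x

/-- The unit scalars act on orthonormal frames by `q • (x, y) = (q x, q y)`. -/
instance Stiefel.instMulAction : MulAction (Metric.sphere (0 : K) 1) (Stiefel K n) where
  smul q f := ⟨((q : K) • f.1.1, (q : K) • f.1.2), by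
    have hq : ‖(q : K)‖ = 1 := by simp
    simp [norm_kvec_smul, hq, f.2.1, f.2.2.1, hermProd_smul_smul, f.2.2.2]⟩
  one_smul f := Subtype.ext (by
    change (((1 : Metric.sphere (0 : K) 1) : K) • f.1.1, ((1 : Metric.sphere (0 : K) 1) : K) • f.1.2)
      = f.1
    simp)
  mul_smul q r f := Subtype.ext (by
    change (((q * r : Metric.sphere (0 : K) 1) : K) • f.1.1,
      ((q * r : Metric.sphere (0 : K) 1) : K) • f.1.2)
      = ((q : K) • (r : K) • f.1.1, (q : K) • (r : K) • f.1.2)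
    simp [mul_smul])

lemma Stiefel.coe_smul (q : Metric.sphere (0 : K) 1) (f : Stiefel K n) :
    (q • f).1 = ((q : K) • f.1.1, (q : K) • f.1.2) := rfl

variable (K) (n) in
/-- The projective Stiefel manifold `W_2(K ^ n)`, the quotient of `V_2(K ^ n)` by the action of
the unit scalars. -/
def ProjStiefel : Type _ := MulAction.orbitRel.Quotient (Metric.sphere (0 : K) 1) (Stiefel K n)

/-- `W_2(K ^ n)` has the quotient topology. -/
instance : TopologicalSpace (ProjStiefel K n) :=
  inferInstanceAs (TopologicalSpace
    (Quotient (MulAction.orbitRel (Metric.sphere (0 : K) 1) (Stiefel K n))))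

/-- The quotient map `V_2(K ^ n) → W_2(K ^ n)`. -/
def ProjStiefel.mk (f : Stiefel K n) : ProjStiefel K n :=
  Quotient.mk (MulAction.orbitRel (Metric.sphere (0 : K) 1) (Stiefel K n)) f

lemma ProjStiefel.isQuotientMap_mk : Topology.IsQuotientMap (ProjStiefel.mk (K := K) (n := n)) :=
  isQuotientMap_quot_mk

lemma ProjStiefel.mk_smul (q : Metric.sphere (0 : K) 1) (f : Stiefel K n) :
    ProjStiefel.mk (q • f) = ProjStiefel.mk f :=
  Quotient.sound ⟨q, rfl⟩

/-- Omitting the `i`-th coordinate. -/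
def dropCoord (i : Fin (n + 1)) (x : KVec K (n + 1)) : KVec K n :=
  WithLp.toLp 2 fun j => x (i.succAbove j)

lemma hermProd_eq (i : Fin (n + 1)) (x y : KVec K (n + 1)) :
    hermProd x y = x i * star (y i) + hermProd (dropCoord i x) (dropCoord i y) :=
  Fin.sum_univ_succAbove _ i

lemma star_hermProd (x y : KVec K n) : star (hermProd x y) = hermProd y x := by
  simp [hermProd]

variable [HermitianScalars K]

lemma hermProd_real_smul_smul (a b : ℝ) (x y : KVec K n) :
    hermProd (a • x) (b • y) = (a * b) • hermProd x y := by
  simp [hermProd, Finset.smul_sum, HermitianScalars.star_smul, HermitianScalars.smul_mul,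
    HermitianScalars.mul_smul, smul_smul, mul_comm]

lemma ContDiffAt.dropCoord {E : Type*} [NormedAddCommGroup E] [NormedSpace ℝ E]
    {m : WithTop ℕ∞} {x : E} {f : E → KVec K (n + 1)} (i : Fin (n + 1))
    (hf : ContDiffAt ℝ m f x) : ContDiffAt ℝ m (fun y => dropCoord i (f y)) x :=
  contDiffAt_piLp (p := 2) |>.2 fun j => hf.coord (i.succAbove j)

lemma insertCoord_ne_zero (i : Fin (n + 1)) (c : K) {z : KVec K n} (hz : z ≠ 0) :
    insertCoord i c z ≠ 0 := fun h => by
  apply hz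
  ext j
  simpa using congrArg (fun x : KVec K (n + 1) => x (i.succAbove j)) h

instance [NeZero n] : Nontrivial (KVec K n) :=
  ⟨⟨0, WithLp.toLp 2 fun _ => 1, fun h => by
    have := congrArg (fun x : KVec K n => x ⟨0, Nat.pos_of_neZero n⟩) h
    simp at this⟩⟩

/-- The unnormalized second vector of `stiefelSlice`. -/
def sliceSnd (i : Fin (n + 1)) (z s : KVec K n) : KVec K (n + 1) :=
  insertCoord i (-hermProd s z) s

/-- The frames `(x, y)` of `V_2(K ^ (n + 1))` with `x_i` real and positive form a slice for the
action of the unit scalars over `{x_i ≠ 0}`, parametrized by `K ^ n × S(K ^ n)`: to `(z, s)`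
corresponds the normalization of the pair of orthogonal vectors
`((1, z), (- ⟨s, z⟩, s))`, the coordinate with index `i` being written first. -/
def stiefelSlice (i : Fin (n + 1)) (p : KVec K n × Metric.sphere (0 : KVec K n) 1) :
    Stiefel K (n + 1) :=
  ⟨(‖insertCoord i 1 p.1‖⁻¹ • insertCoord i 1 p.1,
    ‖sliceSnd i p.1 p.2‖⁻¹ • sliceSnd i p.1 p.2), by
    have h1 : ‖insertCoord i 1 p.1‖ ≠ 0 := norm_ne_zero_iff.2 (insertCoord_one_ne_zero i _)
    have h2 : ‖sliceSnd i p.1 p.2‖ ≠ 0 :=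
      norm_ne_zero_iff.2 (insertCoord_ne_zero i _ (ne_zero_of_mem_unit_sphere p.2))
    refine ⟨?_, ?_, ?_⟩
    · rw [norm_smul, norm_inv, norm_norm, inv_mul_cancel₀ h1]
    · rw [norm_smul, norm_inv, norm_norm, inv_mul_cancel₀ h2]
    · rw [hermProd_real_smul_smul, hermProd_eq i]
      have e1 : dropCoord i (insertCoord i (1 : K) p.1) = p.1 := by ext j; simp [dropCoord]
      have e2 : dropCoord i (sliceSnd i p.1 p.2) = p.2 := by
        ext j; simp [dropCoord, sliceSnd]
      rw [e1, e2]
      simp [sliceSnd, star_hermProd]⟩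

/-- The coordinates `(x, y) ↦ (x_i⁻¹ x', x_i⁻¹ y' / ‖x_i⁻¹ y'‖)`, where `'` means that the
coordinate with index `i` is omitted. -/
def stiefelCoord [NeZero n] (i : Fin (n + 1)) (f : KVec K (n + 1) × KVec K (n + 1)) :
    KVec K n × Metric.sphere (0 : KVec K n) 1 :=
  (affineCoord i f.1, unitDir (dropCoord i ((f.1 i)⁻¹ • f.2)))

lemma stiefelCoord_smul [NeZero n] (i : Fin (n + 1)) (q : Metric.sphere (0 : K) 1)
    (f : Stiefel K (n + 1)) : stiefelCoord i (q • f).1 = stiefelCoord i f.1 := by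
  have hq : (q : K) ≠ 0 := ne_zero_of_mem_unit_sphere q
  simp [stiefelCoord, Stiefel.coe_smul, affineCoord_smul i hq, smul_smul, hq]

lemma dropCoord_ne_zero (i : Fin (n + 1)) {f : Stiefel K (n + 1)} (hf : f.1.1 i ≠ 0) :
    dropCoord i ((f.1.1 i)⁻¹ • f.1.2) ≠ 0 := by
  intro h
  have h0 : ∀ j, f.1.2 (i.succAbove j) = 0 := fun j => by
    have := congrArg (fun x : KVec K n => x j) h
    simpa [dropCoord, hf] using this
  have h1 := f.2.2.2
  rw [hermProd_eq i] at h1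
  have h2 : f.1.2 i = 0 := by
    have : hermProd (dropCoord i f.1.1) (dropCoord i f.1.2) = 0 := by
      simp [hermProd, dropCoord, h0]
    rw [this, add_zero] at h1
    simpa [hf] using h1
  have h3 : f.1.2 = 0 := KVec.ext_succAbove i (by simpa using h2) (by simpa using h0)
  have := f.2.2.1
  simp [h3] at this

instance HermitianScalars.isScalarTower : IsScalarTower ℝ K K :=
  ⟨fun t a b => HermitianScalars.smul_mul t a b⟩

instance HermitianScalars.smulCommClass : SMulCommClass ℝ K K :=
  ⟨fun t a b => (HermitianScalars.mul_smul t a b).symm⟩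

lemma stiefelCoord_real_smul [NeZero n] (i : Fin (n + 1)) {t u : ℝ} (ht : 0 < t) (hu : 0 < u)
    (x y : KVec K (n + 1)) : stiefelCoord i (t • x, u • y) = stiefelCoord i (x, y) := by
  refine Prod.ext ?_ ?_
  · ext j
    simp [stiefelCoord, affineCoord, smul_inv₀, HermitianScalars.mul_smul,
      HermitianScalars.smul_mul, smul_smul, ht.ne']
  · have : dropCoord i (((t • x) i)⁻¹ • u • y) = (t⁻¹ * u) • dropCoord i ((x i)⁻¹ • y) := by
      ext j
      simp [dropCoord, smul_inv₀, HermitianScalars.mul_smul, smul_smul,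
        mul_comm]
    simp only [stiefelCoord]
    rw [this, unitDir_smul (by positivity)]

lemma stiefelCoord_slice [NeZero n] (i : Fin (n + 1))
    (p : KVec K n × Metric.sphere (0 : KVec K n) 1) :
    stiefelCoord i (stiefelSlice i p).1 = p := by
  have h1 : 0 < ‖insertCoord i (1 : K) p.1‖ := norm_pos_iff.2 (insertCoord_one_ne_zero i _)
  have h2 : 0 < ‖sliceSnd i p.1 p.2‖ :=
    norm_pos_iff.2 (insertCoord_ne_zero i _ (ne_zero_of_mem_unit_sphere p.2))
  refine (stiefelCoord_real_smul i (inv_pos.2 h1) (inv_pos.2 h2) _ _).trans ?_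
  have e2 : dropCoord i (sliceSnd i p.1 p.2) = p.2 := by
    ext j; simp [dropCoord, sliceSnd]
  simp [stiefelCoord, e2, unitDir_coe]

lemma sliceSnd_smul (i : Fin (n + 1)) (t : ℝ) (z s : KVec K n) :
    sliceSnd i z (t • s) = t • sliceSnd i z s := by
  have := hermProd_real_smul_smul t 1 s z
  rw [one_smul, mul_one] at this
  refine KVec.ext_succAbove i ?_ fun j => ?_
  · rw [sliceSnd, insertCoord_same, this, PiLp.smul_apply, sliceSnd, insertCoord_same, smul_neg]
  · simp [sliceSnd]

lemma exists_stiefelSlice_eq [NeZero n] (i : Fin (n + 1)) {f : Stiefel K (n + 1)}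
    (hf : f.1.1 i ≠ 0) :
    ∃ q : Metric.sphere (0 : K) 1, stiefelSlice i (stiefelCoord i f.1) = q • f := by
  obtain ⟨⟨x, y⟩, hx, hy, hxy⟩ := f
  simp only at hx hy hxy hf
  have hn : ‖x i‖ ≠ 0 := norm_ne_zero_iff.2 hf
  refine ⟨⟨‖x i‖ • (x i)⁻¹, by simp [norm_smul, hn]⟩, Subtype.ext ?_⟩
  change (stiefelSlice i (stiefelCoord i (x, y))).1 =
    ((‖x i‖ • (x i)⁻¹) • x, (‖x i‖ • (x i)⁻¹) • y)
  have e1 : insertCoord i 1 (affineCoord i x) = (x i)⁻¹ • x := by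
    conv_rhs => rw [← smul_insertCoord_affineCoord (x := x) i hf]
    simp [smul_smul, hf]
  have n1 : ‖(x i)⁻¹ • x‖ = ‖x i‖⁻¹ := by rw [norm_kvec_smul, hx, norm_inv, mul_one]
  have n2 : ‖(x i)⁻¹ • y‖ = ‖x i‖⁻¹ := by rw [norm_kvec_smul, hy, norm_inv, mul_one]
  have hw := dropCoord_ne_zero (f := ⟨(x, y), hx, hy, hxy⟩) i hf
  simp only at hw
  set w := (x i)⁻¹ • y with hw_def
  have e2 : sliceSnd i (affineCoord i x) (dropCoord i w) = w := by
    have h0 : hermProd w ((x i)⁻¹ • x) = 0 := by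
      rw [hw_def, hermProd_smul_smul, ← star_hermProd, hxy]; simp
    rw [← e1, hermProd_eq i] at h0
    have e3 : dropCoord i (insertCoord i (1 : K) (affineCoord i x)) = affineCoord i x := by
      ext j; simp [dropCoord]
    rw [e3, insertCoord_same, star_one, mul_one] at h0
    refine KVec.ext_succAbove i ?_ fun j => ?_
    · rw [sliceSnd, insertCoord_same, ← eq_neg_of_add_eq_zero_left h0]
    · simp [sliceSnd, dropCoord]
  have e4 : sliceSnd i (affineCoord i x) (‖dropCoord i w‖⁻¹ • dropCoord i w) =
      ‖dropCoord i w‖⁻¹ • w := by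
    rw [sliceSnd_smul, e2]
  have n3 : ‖dropCoord i w‖ ≠ 0 := norm_ne_zero_iff.2 hw
  refine Prod.ext ?_ ?_
  · change ‖insertCoord i 1 (affineCoord i x)‖⁻¹ • insertCoord i 1 (affineCoord i x) = _
    rw [e1, n1, inv_inv, smul_assoc]
  · change ‖sliceSnd i (affineCoord i x) (unitDir (dropCoord i w))‖⁻¹ •
      sliceSnd i (affineCoord i x) (unitDir (dropCoord i w)) = _
    rw [coe_unitDir hw, e4, norm_smul, n2, smul_smul, smul_assoc]
    simp
    field_simp
    rfl

lemma contMDiff_stiefelSlice [NeZero n] (i : Fin (n + 1)) :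
    ContMDiff (𝓘(ℝ, KVec K n).prod (𝓡 (Module.finrank ℝ (KVec K n) - 1)))
      𝓘(ℝ, KVec K (n + 1) × KVec K (n + 1)) ∞ (fun p => (stiefelSlice (K := K) i p).1) := by
  intro p
  have h1 : ‖insertCoord i (1 : K) p.1‖ ≠ 0 := norm_ne_zero_iff.2 (insertCoord_one_ne_zero i _)
  have h2 : ‖sliceSnd i p.1 p.2‖ ≠ 0 :=
    norm_ne_zero_iff.2 (insertCoord_ne_zero i _ (ne_zero_of_mem_unit_sphere p.2))
  let F : KVec K n × KVec K n → KVec K (n + 1) × KVec K (n + 1) := fun q =>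
    (‖insertCoord i 1 q.1‖⁻¹ • insertCoord i 1 q.1, ‖sliceSnd i q.1 q.2‖⁻¹ • sliceSnd i q.1 q.2)
  have hF : ContDiffAt ℝ ∞ F (p.1, (p.2 : KVec K n)) := by
    have a1 : ContDiffAt ℝ ∞ (fun q : KVec K n × KVec K n => insertCoord i (1 : K) q.1)
        (p.1, (p.2 : KVec K n)) :=
      ContDiffAt.insertCoord i contDiffAt_const contDiffAt_fst
    have a2 : ContDiffAt ℝ ∞ (fun q : KVec K n × KVec K n => sliceSnd i q.1 q.2)
        (p.1, (p.2 : KVec K n)) :=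
      ContDiffAt.insertCoord i (contDiffAt_snd.hermProd contDiffAt_fst).neg contDiffAt_snd
    exact (((a1.norm ℝ (norm_ne_zero_iff.1 h1)).inv h1).smul a1).prodMk
      (((a2.norm ℝ (norm_ne_zero_iff.1 h2)).inv h2).smul a2)
  have hG : ContMDiff (𝓘(ℝ, KVec K n).prod (𝓡 (Module.finrank ℝ (KVec K n) - 1)))
      𝓘(ℝ, KVec K n × KVec K n) ∞
      (fun p : KVec K n × Metric.sphere (0 : KVec K n) 1 => (p.1, (p.2 : KVec K n))) :=
    contMDiff_fst.prodMk_space (contMDiff_coe_sphere.comp contMDiff_snd)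
  exact ContMDiffAt.comp (g := F) (f := fun p : KVec K n × Metric.sphere (0 : KVec K n) 1 =>
    (p.1, (p.2 : KVec K n))) p hF.contMDiffAt (hG p)

lemma contMDiffAt_stiefelCoord [NeZero n] (i : Fin (n + 1))
    {f : KVec K (n + 1) × KVec K (n + 1)} (hf : f.1 i ≠ 0)
    (hf' : dropCoord i ((f.1 i)⁻¹ • f.2) ≠ 0) :
    ContMDiffAt 𝓘(ℝ, KVec K (n + 1) × KVec K (n + 1))
      (𝓘(ℝ, KVec K n).prod (𝓡 (Module.finrank ℝ (KVec K n) - 1))) ∞ (stiefelCoord i) f := by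
  have a1 : ContDiffAt ℝ ∞
      (fun f : KVec K (n + 1) × KVec K (n + 1) => affineCoord i f.1) f :=
    ContDiffAt.affineCoord i contDiffAt_fst hf
  have a2 : ContDiffAt ℝ ∞
      (fun f : KVec K (n + 1) × KVec K (n + 1) => dropCoord i ((f.1 i)⁻¹ • f.2)) f :=
    ContDiffAt.dropCoord i
      (ContDiffAt.kvecSMul ((contDiffAt_fst.coord i).scalarInv hf) contDiffAt_snd)
  exact a1.contMDiffAt.prodMk ((contMDiffAt_unitDir hf').comp f a2.contMDiffAt)

lemma isOpen_stiefel_ne (i : Fin n) : IsOpen {f : Stiefel K n | f.1.1 i ≠ 0} :=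
  isOpen_ne_fun (((contDiff_coord (m := 0) i).continuous).comp
    (continuous_fst.comp continuous_subtype_val)) continuous_const

/-- The chart of `W_2(K ^ (n + 1))` whose inverse is `stiefelSlice i` followed by the quotient
map. -/
def stiefelChart [NeZero n] (i : Fin (n + 1)) :
    OpenPartialHomeomorph (ProjStiefel K (n + 1)) (KVec K n × Metric.sphere (0 : KVec K n) 1) where
  toFun := Quotient.lift (fun f : Stiefel K (n + 1) => stiefelCoord i f.1) (by
    rintro _ f ⟨q, rfl⟩
    exact stiefelCoord_smul i q f)
  invFun p := ProjStiefel.mk (stiefelSlice i p)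
  source := {w | Quotient.lift (fun f : Stiefel K (n + 1) => f.1.1 i ≠ 0) (by
    rintro _ f ⟨q, rfl⟩
    have hq : (q : K) ≠ 0 := ne_zero_of_mem_unit_sphere q
    simp [Stiefel.coe_smul, hq]) w}
  target := Set.univ
  map_source' _ _ := trivial
  map_target' p _ := by
    change (stiefelSlice i p).1.1 i ≠ 0
    simp [stiefelSlice, insertCoord_one_ne_zero]
  left_inv' := by
    rintro ⟨f⟩ hf
    obtain ⟨q, hq⟩ := exists_stiefelSlice_eq i (f := f) hf
    change ProjStiefel.mk (stiefelSlice i (stiefelCoord i f.1)) = ProjStiefel.mk f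
    rw [hq, ProjStiefel.mk_smul]
  right_inv' p _ := stiefelCoord_slice i p
  open_source := ProjStiefel.isQuotientMap_mk.isOpen_preimage.1 (isOpen_stiefel_ne i)
  open_target := isOpen_univ
  continuousOn_toFun := by
    refine (ProjStiefel.isQuotientMap_mk.continuousOn_isOpen_iff ?_).2 ?_
    · exact ProjStiefel.isQuotientMap_mk.isOpen_preimage.1 (isOpen_stiefel_ne i)
    · intro f hf
      have := (contMDiffAt_stiefelCoord i hf (dropCoord_ne_zero i hf)).continuousAt
      exact (this.comp continuous_subtype_val.continuousAt).continuousWithinAt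
  continuousOn_invFun := by
    refine Continuous.continuousOn (ProjStiefel.isQuotientMap_mk.continuous.comp ?_)
    exact continuous_induced_rng.2 (contMDiff_stiefelSlice i).continuous

lemma exists_mem_stiefelChart_source [NeZero n] (w : ProjStiefel K (n + 1)) :
    ∃ i, w ∈ (stiefelChart i).source := by
  obtain ⟨f⟩ := w
  by_contra! h
  have : f.1.1 = 0 := by
    ext i
    by_contra h'
    exact h i h'
  have h1 := f.2.1
  simp [this] at h1

/-- `W_2(K ^ (n + 1))` is locally modelled on the manifold `K ^ n × S(K ^ n)`. -/
@[reducible] def ProjStiefel.localProductCharts [NeZero n] :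
    ChartedSpace (KVec K n × Metric.sphere (0 : KVec K n) 1) (ProjStiefel K (n + 1)) where
  atlas := Set.range stiefelChart
  chartAt w := stiefelChart (exists_mem_stiefelChart_source w).choose
  mem_chart_source w := (exists_mem_stiefelChart_source w).choose_spec
  chart_mem_atlas _ := ⟨_, rfl⟩

/-- The manifold structure of `W_2(K ^ (n + 1))`. -/
instance ProjStiefel.instChartedSpace [NeZero n] :
    ChartedSpace (ModelProd (KVec K n) (SphereModel (KVec K n))) (ProjStiefel K (n + 1)) :=
  letI := ProjStiefel.localProductCharts (K := K) (n := n)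
  ChartedSpace.comp _ (KVec K n × Metric.sphere (0 : KVec K n) 1) _

instance ProjStiefel.instIsManifold [NeZero n] :
    IsManifold (𝓘(ℝ, KVec K n).prod 𝓘(ℝ, SphereModel (KVec K n))) ∞
      (ProjStiefel K (n + 1)) := by
  let := ProjStiefel.localProductCharts (K := K) (n := n)
  refine isManifold_comp _ (KVec K n × Metric.sphere (0 : KVec K n) 1) _ ?_
  rintro _ ⟨i, rfl⟩ _ ⟨j, rfl⟩ p hp
  rw [OpenPartialHomeomorph.trans_source] at hp
  have h : (stiefelSlice i p).1.1 j ≠ 0 := hp.2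
  exact ((contMDiffAt_stiefelCoord j h (dropCoord_ne_zero j h)).comp p
    (contMDiff_stiefelSlice i p)).contMDiffWithinAt

end Stiefel

section FubiniStudy

open Bundle

variable [HermitianScalars K]

/-- Continuous real bilinear forms on `E`. -/
abbrev BilForm (E : Type*) [NormedAddCommGroup E] [InnerProductSpace ℝ E] : Type _ :=
  E →L[ℝ] E →L[ℝ] ℝ

/-- The orthogonal projection of `K ^ n` onto the `K`-orthogonal complement of `x ≠ 0`. -/
def horizontalPart (x : KVec K n) : KVec K n →L[ℝ] KVec K n :=
  LinearMap.toContinuousLinearMap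
    { toFun := fun a => a - (‖x‖ ^ 2)⁻¹ • (hermProd a x • x)
      map_add' := fun a b => by
        have : hermProd (a + b) x = hermProd a x + hermProd b x := by
          simp [hermProd, add_mul, Finset.sum_add_distrib]
        rw [this, add_smul, smul_add]
        abel
      map_smul' := fun t a => by
        have := hermProd_real_smul_smul t 1 a x
        rw [one_smul, mul_one] at this
        rw [this, smul_assoc, RingHom.id_apply, smul_sub, smul_comm t (‖x‖ ^ 2)⁻¹] }

lemma horizontalPart_apply (x a : KVec K n) :
    horizontalPart x a = a - (‖x‖ ^ 2)⁻¹ • (hermProd a x • x) := rfl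

/-- The form `(a, b) ↦ Re ⟨a', b'⟩ / ‖x‖ ^ 2` on `K ^ n`, where `'` denotes the orthogonal
projection onto the `K`-orthogonal complement of `x ≠ 0`. -/
def horizontalForm (x : KVec K n) : BilForm (KVec K n) :=
  (‖x‖ ^ 2)⁻¹ • (innerSL ℝ).bilinearComp (horizontalPart x) (horizontalPart x)

lemma horizontalForm_apply (x a b : KVec K n) :
    horizontalForm x a b = (‖x‖ ^ 2)⁻¹ * inner ℝ (horizontalPart x a) (horizontalPart x b) := rfl

lemma hermProd_self (x : KVec K n) : hermProd x x = (‖x‖ ^ 2) • (1 : K) := by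
  simp [hermProd, HermitianScalars.mul_star_self, PiLp.norm_sq_eq_of_L2, Finset.sum_smul]

lemma inner_kvec_smul_smul (t : K) (a b : KVec K n) :
    inner ℝ (t • a) (t • b) = ‖t‖ ^ 2 * inner ℝ a b := by
  rw [real_inner_eq_norm_add_mul_self_sub_norm_mul_self_sub_norm_mul_self_div_two,
    real_inner_eq_norm_add_mul_self_sub_norm_mul_self_sub_norm_mul_self_div_two,
    ← smul_add, norm_kvec_smul, norm_kvec_smul, norm_kvec_smul]
  ring

lemma horizontalPart_smul_left {t : K} (ht : t ≠ 0) (x a : KVec K n) :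
    horizontalPart (t • x) a = horizontalPart x a := by
  rw [horizontalPart_apply, horizontalPart_apply]
  have h1 := hermProd_smul_smul 1 t a x
  rw [one_smul, one_mul] at h1
  have h2 : star t * t = (‖t‖ ^ 2) • (1 : K) := by
    have h3 : ‖star t‖ = ‖t‖ := by
      have := congrArg norm (HermitianScalars.mul_star_self t)
      rw [norm_mul, norm_smul, norm_one, mul_one, norm_pow, norm_norm, pow_two] at this
      exact mul_left_cancel₀ (norm_ne_zero_iff.2 ht) this
    simpa [h3] using HermitianScalars.mul_star_self (star t)
  have h4 : ‖t‖ ≠ 0 := norm_ne_zero_iff.2 ht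
  rw [h1, smul_smul, mul_assoc, h2, norm_kvec_smul, HermitianScalars.mul_smul, mul_one,
    smul_assoc, smul_smul]
  congr 2
  field_simp

lemma horizontalPart_add_smul {x : KVec K n} (hx : x ≠ 0) (a : KVec K n) (t : K) :
    horizontalPart x (a + t • x) = horizontalPart x a := by
  have h1 := hermProd_smul_smul t 1 x x
  rw [one_smul, star_one, mul_one, hermProd_self, HermitianScalars.mul_smul, mul_one] at h1
  have h2 : ‖x‖ ^ 2 ≠ 0 := pow_ne_zero _ (norm_ne_zero_iff.2 hx)
  rw [map_add, horizontalPart_apply x (t • x), h1, smul_assoc, smul_smul, inv_mul_cancel₀ h2,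
    one_smul, sub_self, add_zero]

lemma horizontalPart_smul_right (t : K) (x a : KVec K n) :
    horizontalPart x (t • a) = t • horizontalPart x a := by
  have h1 := hermProd_smul_smul t 1 a x
  rw [one_smul, star_one, mul_one] at h1
  rw [horizontalPart_apply, horizontalPart_apply, h1, smul_sub, mul_smul, smul_comm (‖x‖ ^ 2)⁻¹ t]

lemma horizontalForm_invariant {x : KVec K n} (hx : x ≠ 0) {t : K} (ht : t ≠ 0) (u v : K)
    (a b : KVec K n) :
    horizontalForm (t • x) (t • a + u • x) (t • b + v • x) = horizontalForm x a b := by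
  have h : ‖t‖ ≠ 0 := norm_ne_zero_iff.2 ht
  rw [horizontalForm_apply, horizontalForm_apply, horizontalPart_smul_left ht,
    horizontalPart_smul_left ht, horizontalPart_add_smul hx, horizontalPart_add_smul hx,
    horizontalPart_smul_right, horizontalPart_smul_right, inner_kvec_smul_smul, norm_kvec_smul]
  field_simp

/-- The linear map `v ↦ (0, v)`, the coordinate with index `i` being written first. -/
def insertZero (i : Fin (n + 1)) : KVec K n →L[ℝ] KVec K (n + 1) :=
  LinearMap.toContinuousLinearMap
    { toFun := fun v => insertCoord i 0 v
      map_add' := fun v w => KVec.ext_succAbove i (by simp) (by simp)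
      map_smul' := fun t v => KVec.ext_succAbove i (by simp) (by simp) }

lemma insertZero_apply (i : Fin (n + 1)) (v : KVec K n) :
    insertZero i v = insertCoord i 0 v := rfl

/-- The Fubini-Study metric in the affine chart with index `i`, at the point with coordinates `z`:
the pull-back of `horizontalForm` by the section `z ↦ (1, z)`. -/
def affineForm (i : Fin (n + 1)) (z : KVec K n) : BilForm (KVec K n) :=
  (horizontalForm (insertCoord i 1 z)).bilinearComp (insertZero i) (insertZero i)

lemma affineForm_apply (i : Fin (n + 1)) (z v w : KVec K n) :
    affineForm i z v w =
      horizontalForm (insertCoord i 1 z) (insertCoord i 0 v) (insertCoord i 0 w) := rfl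

lemma affineForm_symm (i : Fin (n + 1)) (z v w : KVec K n) :
    affineForm i z v w = affineForm i z w v := by
  rw [affineForm_apply, affineForm_apply, horizontalForm_apply, horizontalForm_apply,
    real_inner_comm]

lemma norm_insertCoord_zero (i : Fin (n + 1)) (v : KVec K n) : ‖insertCoord i (0 : K) v‖ = ‖v‖ := by
  rw [PiLp.norm_eq_of_L2, PiLp.norm_eq_of_L2, Fin.sum_univ_succAbove _ i]
  simp

lemma norm_le_horizontalPart (i : Fin (n + 1)) (z v : KVec K n) :
    ‖v‖ ≤ (1 + ‖insertCoord i (1 : K) z‖) *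
      ‖horizontalPart (insertCoord i 1 z) (insertCoord i 0 v)‖ := by
  set x : KVec K (n + 1) := insertCoord i 1 z
  set a : KVec K (n + 1) := insertCoord i 0 v with ha
  set l : K := (‖x‖ ^ 2)⁻¹ • hermProd a x
  have h1 : horizontalPart x a = a - l • x := by rw [horizontalPart_apply, smul_assoc]
  have h2 : ‖l‖ ≤ ‖horizontalPart x a‖ := by
    have h3 := PiLp.norm_apply_le (horizontalPart x a) i
    have h4 : horizontalPart x a i = -l := by
      rw [h1]
      simp [a, x]
    rwa [h4, norm_neg] at h3
  have h5 : ‖a‖ ≤ ‖horizontalPart x a‖ + ‖l‖ * ‖x‖ := by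
    have h6 : a = horizontalPart x a + l • x := by rw [h1, sub_add_cancel]
    calc ‖a‖ = ‖horizontalPart x a + l • x‖ := congrArg norm h6
      _ ≤ _ := norm_add_le _ _
      _ = _ := by rw [norm_kvec_smul]
  rw [ha, norm_insertCoord_zero] at h5
  nlinarith [norm_nonneg x]

lemma norm_sq_le_affineForm (i : Fin (n + 1)) (z v : KVec K n) :
    ‖v‖ ^ 2 ≤ ((1 + ‖insertCoord i (1 : K) z‖) * ‖insertCoord i (1 : K) z‖) ^ 2 *
      affineForm i z v v := by
  have h1 := norm_le_horizontalPart i z v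
  have h2 : ‖insertCoord i (1 : K) z‖ ≠ 0 := norm_ne_zero_iff.2 (insertCoord_one_ne_zero i z)
  rw [affineForm_apply, horizontalForm_apply, real_inner_self_eq_norm_sq]
  refine (pow_le_pow_left₀ (norm_nonneg _) h1 2).trans (le_of_eq ?_)
  field_simp

lemma contDiff_affineForm (i : Fin (n + 1)) : ContDiff ℝ ∞ (affineForm (K := K) (n := n) i) := by
  refine contDiff_clm_apply_iff.2 fun v => contDiff_clm_apply_iff.2 fun w => ?_
  refine contDiff_iff_contDiffAt.2 fun z => ?_
  simp only [affineForm_apply, horizontalForm_apply, horizontalPart_apply]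
  have h0 := insertCoord_one_ne_zero i z
  have h1 : ContDiffAt ℝ ∞ (fun z : KVec K n => insertCoord i (1 : K) z) z :=
    ContDiffAt.insertCoord i contDiffAt_const contDiffAt_id
  have h2 : ContDiffAt ℝ ∞ (fun z : KVec K n => (‖insertCoord i (1 : K) z‖ ^ 2)⁻¹) z :=
    (h1.norm_sq ℝ).inv (pow_ne_zero _ (norm_ne_zero_iff.2 h0))
  have h3 : ∀ v : KVec K n, ContDiffAt ℝ ∞ (fun z : KVec K n => insertCoord i (0 : K) v -
      (‖insertCoord i (1 : K) z‖ ^ 2)⁻¹ • (hermProd (insertCoord i (0 : K) v)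
        (insertCoord i (1 : K) z) • insertCoord i (1 : K) z)) z := fun v =>
    contDiffAt_const.sub (h2.smul ((contDiffAt_const.hermProd h1).kvecSMul h1))
  exact h2.mul ((h3 v).inner ℝ (h3 w))

lemma contDiff_smul_affineForm (c : ℝ) (i : Fin (n + 1)) :
    ContDiff ℝ ∞ (fun z : KVec K n => (c • affineForm i z : BilForm (KVec K n))) := by
  refine contDiff_clm_apply_iff.2 fun v => contDiff_clm_apply_iff.2 fun w => ?_
  have h1 := contDiff_clm_apply_iff.1 (contDiff_clm_apply_iff.1 (contDiff_affineForm i) v) w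
  exact contDiff_const.mul h1

lemma insertCoord_affineCoord (i : Fin (n + 1)) {x : KVec K (n + 1)} (hx : x i ≠ 0) :
    insertCoord i 1 (affineCoord i x) = (x i)⁻¹ • x := by
  conv_rhs => rw [← smul_insertCoord_affineCoord (x := x) i hx]
  simp [smul_smul, hx]

lemma insertCoord_fderiv (i j : Fin (n + 1)) {z : KVec K n}
    (hz : insertCoord i (1 : K) z j ≠ 0) (v : KVec K n) :
    ∃ u : K, insertCoord j 0 (fderiv ℝ (fun z => affineCoord j (insertCoord i (1 : K) z)) z v) =
      (insertCoord i (1 : K) z j)⁻¹ • insertCoord i 0 v + u • insertCoord i (1 : K) z := by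
  let := HermitianScalars.normedAlgebra (K := K)
  have c1 : ContDiffAt ℝ 1 (fun z : KVec K n => insertCoord i (1 : K) z) z :=
    ContDiffAt.insertCoord i contDiffAt_const contDiffAt_id
  have c2 : ContDiffAt ℝ 1 (fun z : KVec K n => affineCoord j (insertCoord i (1 : K) z)) z :=
    c1.affineCoord j hz
  have c3 : ContDiffAt ℝ 1 (fun z : KVec K n => (insertCoord i (1 : K) z j)⁻¹) z :=
    (c1.coord j).scalarInv hz
  have hγ : HasDerivAt (fun t : ℝ => z + t • v) v 0 := by
    simpa using ((hasDerivAt_id (0 : ℝ)).smul_const v).const_add z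
  have hγ0 : z + (0 : ℝ) • v = z := by simp
  have d2 := HasFDerivAt.comp_hasDerivAt_of_eq (0 : ℝ)
    (c2.differentiableAt one_ne_zero).hasFDerivAt hγ hγ0.symm
  have d3 := HasFDerivAt.comp_hasDerivAt_of_eq (0 : ℝ)
    (c3.differentiableAt one_ne_zero).hasFDerivAt hγ hγ0.symm
  refine ⟨fderiv ℝ (fun z : KVec K n => (insertCoord i (1 : K) z j)⁻¹) z v, ?_⟩
  ext k
  have d1 : HasDerivAt (fun t : ℝ => insertCoord i (1 : K) (z + t • v) k)
      (insertCoord i (0 : K) v k) 0 := by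
    have e : (fun t : ℝ => insertCoord i (1 : K) (z + t • v) k) =
        fun t : ℝ => insertCoord i (1 : K) z k + t • insertCoord i (0 : K) v k := by
      funext t
      have : insertCoord i (1 : K) (z + t • v) =
          insertCoord i (1 : K) z + t • insertCoord i (0 : K) v :=
        KVec.ext_succAbove i (by simp) (by simp)
      rw [this]
      rfl
    rw [e]
    simpa using ((hasDerivAt_id (0 : ℝ)).smul_const
      (insertCoord i (0 : K) v k)).const_add (insertCoord i (1 : K) z k)
  have d4 := d3.mul d1
  have d5 : HasDerivAt (fun t : ℝ =>
      insertCoord j (1 : K) (affineCoord j (insertCoord i (1 : K) (z + t • v))) k)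
      (insertCoord j 0
        (fderiv ℝ (fun z => affineCoord j (insertCoord i (1 : K) z)) z v) k) 0 := by
    rcases Fin.eq_self_or_eq_succAbove j k with rfl | ⟨l, rfl⟩
    · simpa using hasDerivAt_const (0 : ℝ) (1 : K)
    · simp only [insertCoord_succAbove]
      exact (PiLp.proj (𝕜 := ℝ) 2 (fun _ : Fin n => K) l).hasFDerivAt.comp_hasDerivAt (0 : ℝ) d2
  have hev : ∀ᶠ t : ℝ in nhds 0, insertCoord i (1 : K) (z + t • v) j ≠ 0 := by
    have hc : ContinuousAt (fun t : ℝ => insertCoord i (1 : K) (z + t • v) j) 0 := by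
      have := (c1.coord j).continuousAt
      exact ContinuousAt.comp_of_eq this hγ.continuousAt hγ0
    refine hc.eventually_ne ?_
    rwa [hγ0]
  have d6 := d4.congr_of_eventuallyEq (f₁ := fun t : ℝ =>
      insertCoord j (1 : K) (affineCoord j (insertCoord i (1 : K) (z + t • v))) k) (by
    filter_upwards [hev] with t ht
    rw [insertCoord_affineCoord j ht]
    rfl)
  have := d5.unique d6
  rw [this]
  simp [add_comm]

/-- Affine forms correspond to each other under changes of affine charts. -/
lemma affineForm_coordChange (i j : Fin (n + 1)) {z : KVec K n}
    (hz : insertCoord i (1 : K) z j ≠ 0) (v w : KVec K n) :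
    affineForm j (affineCoord j (insertCoord i 1 z))
      (fderiv ℝ (fun z => affineCoord j (insertCoord i (1 : K) z)) z v)
      (fderiv ℝ (fun z => affineCoord j (insertCoord i (1 : K) z)) z w) = affineForm i z v w := by
  obtain ⟨a, ha⟩ := insertCoord_fderiv i j hz v
  obtain ⟨b, hb⟩ := insertCoord_fderiv i j hz w
  rw [affineForm_apply, affineForm_apply, ha, hb, insertCoord_affineCoord j hz,
    horizontalForm_invariant (insertCoord_one_ne_zero i z) (inv_ne_zero hz)]

/-- The index of the preferred affine chart at `p`. -/
def chartIndex (p : KProj K n) : Fin (n + 1) := (exists_mem_affineChart_source p).choose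

lemma chartAt_eq (p : KProj K n) : chartAt (KVec K n) p = affineChart (chartIndex p) := rfl

/-- The inner product `c • g` on the tangent space of `K P ^ n` at `p`, where `g` is the
Fubini-Study metric. -/
def fubiniStudyInner (c : ℝ) (p : KProj K n) :
    TangentSpace 𝓘(ℝ, KVec K n) p →L[ℝ] TangentSpace 𝓘(ℝ, KVec K n) p →L[ℝ] ℝ :=
  (c • affineForm (chartIndex p) (chartAt (KVec K n) p p) : BilForm (KVec K n))

lemma fubiniStudyInner_apply (c : ℝ) (p : KProj K n) (v w : KVec K n) :
    fubiniStudyInner c p v w = c * affineForm (chartIndex p) (chartAt (KVec K n) p p) v w := rfl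

lemma fubiniStudyInner_pos {c : ℝ} (hc : 0 < c) (p : KProj K n) {v : KVec K n} (hv : v ≠ 0) :
    0 < fubiniStudyInner c p v v := by
  rw [fubiniStudyInner_apply]
  have h1 := norm_sq_le_affineForm (chartIndex p) (chartAt (KVec K n) p p) v
  have h2 : 0 < ‖v‖ ^ 2 := pow_pos (norm_pos_iff.2 hv) 2
  exact mul_pos hc (pos_of_mul_pos_right (h2.trans_le h1) (sq_nonneg _))

lemma fubiniStudyInner_bounded {c : ℝ} (hc : 0 < c) (p : KProj K n) :
    Bornology.IsVonNBounded ℝ {v : KVec K n | fubiniStudyInner c p v v < 1} := by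
  refine (NormedSpace.isVonNBounded_iff ℝ (E := KVec K n)).2 ?_
  set x : KVec K (n + 1) := insertCoord (chartIndex p) 1 (chartAt (KVec K n) p p)
  refine (isBounded_iff_forall_norm_le).2 ⟨1 + ((1 + ‖x‖) * ‖x‖) ^ 2 / c, fun v hv => ?_⟩
  have hv' : fubiniStudyInner c p v v < 1 := hv
  have h1 : ‖v‖ ^ 2 ≤ ((1 + ‖x‖) * ‖x‖) ^ 2 * _ :=
    norm_sq_le_affineForm (chartIndex p) (chartAt (KVec K n) p p) v
  rw [fubiniStudyInner_apply, mul_comm, ← lt_div_iff₀ hc] at hv'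
  have h2 := h1.trans (mul_le_mul_of_nonneg_left hv'.le (sq_nonneg ((1 + ‖x‖) * ‖x‖)))
  rw [mul_one_div] at h2
  nlinarith [sq_nonneg (‖v‖ - 1)]

lemma fubiniStudyInner_coordChange {c : ℝ} {p q : KProj K n}
    (hq : q ∈ (chartAt (KVec K n) p).source) (v w : KVec K n) :
    fubiniStudyInner c q
      ((trivializationAt (KVec K n) (TangentSpace 𝓘(ℝ, KVec K n)) p).symm q v)
      ((trivializationAt (KVec K n) (TangentSpace 𝓘(ℝ, KVec K n)) p).symm q w) =
    c * affineForm (chartIndex p) (chartAt (KVec K n) p q) v w := by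
  have key : ∀ v : KVec K n,
      (trivializationAt (KVec K n) (TangentSpace 𝓘(ℝ, KVec K n)) p).symm q v =
        fderiv ℝ (fun z => affineCoord (chartIndex q) (insertCoord (chartIndex p) (1 : K) z))
          (chartAt (KVec K n) p q) v := by
    intro v
    have h1 := TangentBundle.symmL_trivializationAt_eq_core (I := 𝓘(ℝ, KVec K n)) hq
    have h2 := congrArg (fun L => L v) h1
    refine Eq.trans (Bundle.Trivialization.symmL_apply _ hq v).symm (h2.trans ?_)
    rw [tangentBundleCore_coordChange_achart]
    simp only [mfld_simps, fderivWithin_univ]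
    have h3 : (chartAt (KVec K n) q ∘ (chartAt (KVec K n) p).symm : KVec K n → KVec K n) =
        fun z => affineCoord (chartIndex q) (insertCoord (chartIndex p) (1 : K) z) := by
      funext z
      exact affineChart_toProj _ (insertCoord_one_ne_zero _ z)
    exact congrArg (fun f : KVec K n → KVec K n => fderiv ℝ f (chartAt (KVec K n) p q) v) h3
  have hp : q = toProj (insertCoord (chartIndex p) (1 : K) (chartAt (KVec K n) p q)) :=
    ((chartAt (KVec K n) p).left_inv hq).symm
  have h4 : chartAt (KVec K n) q q = affineCoord (chartIndex q)
      (insertCoord (chartIndex p) (1 : K) (chartAt (KVec K n) p q)) :=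
    (congrArg (chartAt (KVec K n) q) hp).trans
      (affineChart_toProj _ (insertCoord_one_ne_zero _ _))
  have h5 : insertCoord (chartIndex p) (1 : K) (chartAt (KVec K n) p q) (chartIndex q) ≠ 0 := by
    refine (toProj_mem_affineChart_source (chartIndex q) (insertCoord_one_ne_zero _ _)).1 ?_
    rw [← hp]
    exact mem_chart_source (KVec K n) q
  refine (fubiniStudyInner_apply c q _ _).trans ?_
  rw [h4, ← affineForm_coordChange _ _ h5]
  exact congrArg₂ (fun a b => c * affineForm _ _ a b) (key v) (key w)

/-- The Riemannian metric `c • g` on `K P ^ n`, where `c > 0` and `g` is the Fubini-Study metric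
(for `K = ℝ`, the round metric), i.e. the one for which the projection of the unit sphere of
`K ^ (n + 1)` onto `K P ^ n` is a Riemannian submersion. -/
def fubiniStudy {c : ℝ} (hc : 0 < c) : RiemMetric (KVec K n) (KProj K n) where
  inner := fubiniStudyInner c
  symm p v w := congrArg (c * ·) (affineForm_symm (chartIndex p) (chartAt (KVec K n) p p) v w)
  pos p v hv := fubiniStudyInner_pos hc p hv
  isVonNBounded p := fubiniStudyInner_bounded hc p
  contMDiff := by
    intro p
    rw [contMDiffAt_section]
    have h1 : ContMDiffAt 𝓘(ℝ, KVec K n) 𝓘(ℝ, BilForm (KVec K n)) ∞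
        (fun q : KProj K n => c • affineForm (chartIndex p) (chartAt (KVec K n) p q)) p :=
      (contDiff_smul_affineForm c (chartIndex p)).contMDiff.contMDiffAt.comp p
        (contMDiffAt_of_mem_maximalAtlas (IsManifold.chart_mem_maximalAtlas p)
          (mem_chart_source (KVec K n) p))
    refine h1.congr_of_eventuallyEq ?_
    filter_upwards [(chartAt (KVec K n) p).open_source.mem_nhds (mem_chart_source _ p)] with q hq
    ext v w
    rw [hom_trivializationAt_apply]
    refine (inCoordinates_apply_eq₂ hq hq (Set.mem_univ _)).trans ?_
    refine Eq.trans ?_ (fubiniStudyInner_coordChange (c := c) hq v w)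
    simp

end FubiniStudy

end ProjectiveSpace
end

/-!
The argument is uniform in the division ring `K`, an instance of `HermitianScalars`.

The map `(x, y) ↦ (r / √c) d π_x (y)` is constant on the orbits of the unit scalars, because
`π (q x) = π x` forces `d π_{q x} (q y) = d π_x (y)` (`projTangent_smul_smul`); and it takes its
values in `T_r K P ^ n`, because `d π_x` is isometric on the `K`-orthogonal complement of the unit
vector `x` (`normSq_projTangent`). It therefore descends to a map
`projStiefelToTangent : W_2(K ^ (n + 1)) → T_r K P ^ n`.

Over the open set where `x_i ≠ 0`, both manifolds are parametrized by `K ^ n × S(K ^ n)`, the first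
factor being the affine coordinates `z = (x_i⁻¹ x_j)_{j ≠ i}`. The second one is the direction of
`x_i⁻¹ y'` for `W_2(K ^ (n + 1))`, where `y'` is `y` without its coordinate of index `i`, and the
direction of `d z (y)` for `T_r K P ^ n`. Since `d z_j (y) = x_i⁻¹ y_j - x_i⁻¹ y_i z_j`, and since
`⟨x, y⟩ = 0` means that `x_i⁻¹ y_i = - ⟨x_i⁻¹ y', z⟩`, one has `d z (y) = A_z (x_i⁻¹ y')` for the
`K`-linear map `A_z v = v + ⟨v, z⟩ z` (`affineDeriv_eq_hermShear`). So in these coordinates the map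
is `(z, s) ↦ (z, A_z s / ‖A_z s‖)` (`tangentSphereChart_projStiefelToTangent`), whose inverse is
obtained from `A_z⁻¹ v = v - ⟨v, z⟩ z / (1 + ‖z‖ ^ 2)`. Both are smooth. As the map covers the
identity of `K P ^ n`, these local inverses are the restrictions of a global one.
-/

noncomputable section

/-! ### Charts with values in a manifold -/

section ChartsOfComp

variable {E H : Type*} [NormedAddCommGroup E] [NormedSpace ℝ E] [TopologicalSpace H]
  {I : ModelWithCorners ℝ E H} {Y X : Type*} [TopologicalSpace Y] [ChartedSpace H Y]
  [IsManifold I ∞ Y] [TopologicalSpace X] [ChartedSpace H X] [IsManifold I ∞ X]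
  {e : OpenPartialHomeomorph X Y}

/-- A `Y`-valued partial homeomorphism on `X` whose composites with the charts of `Y` are charts of
`X` is smooth: near each point it is `c.symm ∘ (e ≫ₕ c)` for a chart `c` of `Y`. -/
lemma contMDiffOn_of_trans_mem_atlas (he : ∀ c ∈ atlas H Y, e ≫ₕ c ∈ atlas H X) :
    ContMDiffOn I I ∞ e e.source := by
  intro x hx
  set c := chartAt H (e x)
  have hc : e x ∈ c.source := mem_chart_source H (e x)
  have h1 : ContMDiffAt I I ∞ (e ≫ₕ c) x :=
    contMDiffAt_of_mem_maximalAtlas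
      (IsManifold.subset_maximalAtlas (he c (chart_mem_atlas H (e x))))
      (by simp [hx, hc])
  have h2 : ContMDiffAt I I ∞ c.symm (c (e x)) :=
    contMDiffAt_symm_of_mem_maximalAtlas (IsManifold.chart_mem_maximalAtlas (e x))
      (c.map_source hc)
  refine ((ContMDiffAt.comp x (g := c.symm) h2 h1).congr_of_eventuallyEq ?_).contMDiffWithinAt
  filter_upwards [(e ≫ₕ c).open_source.mem_nhds
    (show x ∈ (e ≫ₕ c).source by simp [hx, hc])] with y hy
  rw [OpenPartialHomeomorph.trans_source] at hy
  exact (c.left_inv hy.2).symm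

lemma contMDiffOn_symm_of_trans_mem_atlas (he : ∀ c ∈ atlas H Y, e ≫ₕ c ∈ atlas H X) :
    ContMDiffOn I I ∞ e.symm e.target := by
  intro y hy
  set c := chartAt H y
  have hc : y ∈ c.source := mem_chart_source H y
  have h1 : ContMDiffAt I I ∞ c y := contMDiffAt_of_mem_maximalAtlas
    (IsManifold.chart_mem_maximalAtlas y) hc
  have h2 : ContMDiffAt I I ∞ (e ≫ₕ c).symm (c y) :=
    contMDiffAt_symm_of_mem_maximalAtlas
      (IsManifold.subset_maximalAtlas (he c (chart_mem_atlas H y)))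
      (by simp [hy, hc])
  refine ((ContMDiffAt.comp y h2 h1).congr_of_eventuallyEq ?_).contMDiffWithinAt
  filter_upwards [c.open_source.mem_nhds hc] with z hz
  exact congrArg e.symm (c.left_inv hz).symm

end ChartsOfComp

/-! ### Coordinates of tangent vectors -/

section TangentSphere

variable {E : Type*} [NormedAddCommGroup E] [InnerProductSpace ℝ E]
  {M : Type*} [TopologicalSpace M] [ChartedSpace E M]

/-- Every tangent space of `M` is by definition the model space `E`, so that vectors at `p` and at
`p'` can be compared without transport. -/
lemma tangentBundle_mk_congr {p p' : M} (hp : p = p') {v : TangentSpace 𝓘(ℝ, E) p}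
    {v' : TangentSpace 𝓘(ℝ, E) p'} (hv : (v : E) = (v' : E)) :
    (⟨p, v⟩ : TangentBundle 𝓘(ℝ, E) M) = ⟨p', v'⟩ := by
  subst hp
  exact congrArg _ hv

variable [IsManifold 𝓘(ℝ, E) ∞ M]

/-- In the chart of `T M` induced by the chart of `M` at `p`, the fibre coordinates of a tangent
vector are its image under the differential of that chart. -/
lemma tangentChart_mk (p q : M) (hq : q ∈ (chartAt E p).source) (v : TangentSpace 𝓘(ℝ, E) q) :
    tangentChart p (⟨q, v⟩ : TangentBundle 𝓘(ℝ, E) M) =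
      (chartAt E p q, mfderiv 𝓘(ℝ, E) 𝓘(ℝ, E) (chartAt E p) q v) := by
  refine Prod.ext rfl ?_
  have h := congrArg (fun L => L v)
    (TangentBundle.continuousLinearMapAt_trivializationAt (I := 𝓘(ℝ, E)) hq)
  refine Eq.trans ?_ h
  exact (congrFun (Bundle.Trivialization.coe_linearMapAt_of_mem (R := ℝ)
    (trivializationAt E (TangentSpace 𝓘(ℝ, E)) p) hq) v).symm

variable [FiniteDimensional ℝ E] [Nontrivial E] (g : RiemMetric E M) {r : ℝ} (hr : 0 < r)

lemma contMDiffOn_tangentSphereChart (p : M) :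
    ContMDiffOn (𝓘(ℝ, E).prod 𝓘(ℝ, SphereModel E)) (𝓘(ℝ, E).prod 𝓘(ℝ, SphereModel E)) ∞
      (tangentSphereChart g hr p) (tangentSphereChart g hr p).source :=
  contMDiffOn_of_trans_mem_atlas fun c hc => ⟨_, ⟨p, rfl⟩, c, hc, rfl⟩

lemma contMDiffOn_tangentSphereChart_symm (p : M) :
    ContMDiffOn (𝓘(ℝ, E).prod 𝓘(ℝ, SphereModel E)) (𝓘(ℝ, E).prod 𝓘(ℝ, SphereModel E)) ∞
      (tangentSphereChart g hr p).symm (tangentSphereChart g hr p).target :=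
  contMDiffOn_symm_of_trans_mem_atlas fun c hc => ⟨_, ⟨p, rfl⟩, c, hc, rfl⟩

end TangentSphere

/-! ### Affine coordinates of orthonormal frames -/

section HermitianProduct

variable {K : Type*} [NormedDivisionRing K] [StarRing K] {n : ℕ}

lemma hermProd_add_left (a b z : KVec K n) :
    hermProd (a + b) z = hermProd a z + hermProd b z := by
  simp [hermProd, add_mul, Finset.sum_add_distrib]

lemma Stiefel.fst_ne_zero (f : Stiefel K n) : f.1.1 ≠ 0 :=
  norm_ne_zero_iff.1 (by simp [f.2.1])

end HermitianProduct

section ProjectiveSpace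

variable {K : Type*} [NormedDivisionRing K] [InnerProductSpace ℝ K] [StarRing K] {n : ℕ}

/-- The derivative at `x`, in the direction `y`, of the affine coordinates
`x ↦ (x_i⁻¹ x_j)_{j ≠ i}`, where `x_i ≠ 0` (see `fderiv_affineCoord_apply`). -/
def affineDeriv (i : Fin (n + 1)) (x y : KVec K (n + 1)) : KVec K n :=
  dropCoord i ((x i)⁻¹ • y) - ((x i)⁻¹ * y i) • affineCoord i x

lemma insertCoord_affineDeriv (i : Fin (n + 1)) {x : KVec K (n + 1)} (hx : x i ≠ 0)
    (y : KVec K (n + 1)) :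
    insertCoord i 0 (affineDeriv i x y) =
      (x i)⁻¹ • y + (-((x i)⁻¹ * y i * (x i)⁻¹)) • x := by
  refine KVec.ext_succAbove i ?_ fun j => ?_
  · simp [mul_assoc, hx]
  · simp [affineDeriv, dropCoord, affineCoord, mul_assoc, sub_eq_add_neg]

lemma affineDeriv_smul_smul (i : Fin (n + 1)) {q : K} (hq : q ≠ 0) (x y : KVec K (n + 1)) :
    affineDeriv i (q • x) (q • y) = affineDeriv i x y := by
  simp [affineDeriv, affineCoord_smul i hq, smul_smul, mul_assoc, hq]

lemma hermProd_smul_left (a : K) (x z : KVec K n) : hermProd (a • x) z = a * hermProd x z := by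
  simpa using hermProd_smul_smul a 1 x z

/-- The `K`-linear map `v ↦ v + ⟨v, z⟩ z` of `K ^ n`. -/
def hermShear (z v : KVec K n) : KVec K n := v + hermProd v z • z

/-- If `y` is orthogonal to `x`, its coordinate `y_i` is determined by the other ones, and the
derivative of the affine coordinates becomes a function of these: the shear by `affineCoord i x`. -/
lemma affineDeriv_eq_hermShear (i : Fin (n + 1)) {x y : KVec K (n + 1)} (hx : x i ≠ 0)
    (hxy : hermProd x y = 0) :
    affineDeriv i x y = hermShear (affineCoord i x) (dropCoord i ((x i)⁻¹ • y)) := by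
  have h0 : hermProd ((x i)⁻¹ • y) ((x i)⁻¹ • x) = 0 := by
    rw [hermProd_smul_smul, ← star_hermProd, hxy]
    simp
  have e : dropCoord i ((x i)⁻¹ • x) = affineCoord i x := by
    ext j
    simp [dropCoord, affineCoord]
  rw [hermProd_eq i, e] at h0
  have h1 : hermProd (dropCoord i ((x i)⁻¹ • y)) (affineCoord i x) = -((x i)⁻¹ * y i) := by
    rw [eq_neg_of_add_eq_zero_right h0]
    simp [hx]
  rw [affineDeriv, hermShear, h1, neg_smul, sub_eq_add_neg]

variable [HermitianScalars K]

lemma contMDiffOn_stiefelChart [NeZero n] (i : Fin (n + 1)) :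
    ContMDiffOn (𝓘(ℝ, KVec K n).prod 𝓘(ℝ, SphereModel (KVec K n)))
      (𝓘(ℝ, KVec K n).prod 𝓘(ℝ, SphereModel (KVec K n))) ∞
      (stiefelChart (K := K) i) (stiefelChart (K := K) i).source :=
  contMDiffOn_of_trans_mem_atlas fun c hc => ⟨_, ⟨i, rfl⟩, c, hc, rfl⟩

lemma contMDiffOn_stiefelChart_symm [NeZero n] (i : Fin (n + 1)) :
    ContMDiffOn (𝓘(ℝ, KVec K n).prod 𝓘(ℝ, SphereModel (KVec K n)))
      (𝓘(ℝ, KVec K n).prod 𝓘(ℝ, SphereModel (KVec K n))) ∞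
      (stiefelChart (K := K) i).symm (stiefelChart (K := K) i).target :=
  contMDiffOn_symm_of_trans_mem_atlas fun c hc => ⟨_, ⟨i, rfl⟩, c, hc, rfl⟩

lemma fderiv_affineCoord_apply (i : Fin (n + 1)) {x : KVec K (n + 1)} (hx : x i ≠ 0)
    (y : KVec K (n + 1)) : fderiv ℝ (affineCoord i) x y = affineDeriv i x y := by
  let := HermitianScalars.normedAlgebra (K := K)
  have hγ : HasDerivAt (fun t : ℝ => x + t • y) y 0 := by
    simpa using ((hasDerivAt_id (0 : ℝ)).smul_const y).const_add x
  have hγ0 : x + (0 : ℝ) • y = x := by simp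
  have d := HasFDerivAt.comp_hasDerivAt_of_eq (0 : ℝ)
    ((ContDiffAt.affineCoord (m := 1) i (contDiffAt_id (x := x)) hx).differentiableAt
      one_ne_zero).hasFDerivAt hγ hγ0.symm
  ext j
  have dc : ∀ k, HasDerivAt (fun t : ℝ => (x + t • y) k) (y k) 0 := fun k =>
    (PiLp.proj (𝕜 := ℝ) 2 (fun _ : Fin (n + 1) => K) k).hasFDerivAt.comp_hasDerivAt (0 : ℝ) hγ
  have da : HasDerivAt (fun t : ℝ => affineCoord i (x + t • y) j)
      (fderiv ℝ (affineCoord i) x y j) 0 :=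
    (PiLp.proj (𝕜 := ℝ) 2 (fun _ : Fin n => K) j).hasFDerivAt.comp_hasDerivAt (0 : ℝ) d
  -- differentiating `x_i * (x_i⁻¹ * x_j) = x_j` avoids the derivative of the inverse
  have dm := (dc i).mul da
  have hev : ∀ᶠ t : ℝ in nhds 0, (x + t • y) i ≠ 0 :=
    (dc i).continuousAt.eventually_ne (by simpa using hx)
  have dm' := dm.congr_of_eventuallyEq (f₁ := fun t : ℝ => (x + t • y) (i.succAbove j)) (by
    filter_upwards [hev] with t ht
    simp only [Pi.mul_apply, affineCoord]
    rw [mul_inv_cancel_left₀ ht])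
  have h := dm'.unique (dc (i.succAbove j))
  rw [hγ0] at h
  have h' : fderiv ℝ (affineCoord i) x y j =
      (x i)⁻¹ * (y (i.succAbove j) - y i * affineCoord i x j) := by
    rw [← h, add_sub_cancel_left, inv_mul_cancel_left₀ hx]
  rw [h']
  simp [affineDeriv, dropCoord, mul_sub, mul_assoc]

/-! ### The differential of the projection -/

lemma contMDiffAt_toProj {x : KVec K (n + 1)} (hx : x ≠ 0) :
    ContMDiffAt 𝓘(ℝ, KVec K (n + 1)) 𝓘(ℝ, KVec K n) ∞ toProj x := by
  obtain ⟨i, hi⟩ := exists_mem_affineChart_source (toProj x)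
  have hi' := (toProj_mem_affineChart_source i hx).1 hi
  have h1 : ContMDiffAt 𝓘(ℝ, KVec K n) 𝓘(ℝ, KVec K n) ∞ (affineChart (K := K) i).symm
      (affineCoord i x) :=
    contMDiffAt_symm_of_mem_maximalAtlas (IsManifold.subset_maximalAtlas ⟨i, rfl⟩) trivial
  have h2 : ContDiffAt ℝ ∞ (affineCoord (K := K) i) x := ContDiffAt.affineCoord i contDiffAt_id hi'
  refine (h1.comp x h2.contMDiffAt).congr_of_eventuallyEq ?_
  have hev : ∀ᶠ y : KVec K (n + 1) in nhds x, y i ≠ 0 :=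
    (contDiff_coord (m := 0) i).continuous.continuousAt.eventually_ne hi'
  filter_upwards [hev] with y hy
  have hy0 := ne_zero_of_coord hy
  have := (affineChart i).left_inv ((toProj_mem_affineChart_source i hy0).2 hy)
  rw [affineChart_toProj i hy0] at this
  exact this.symm

lemma mfderiv_affineChart_mfderiv_toProj (p : KProj K n) {x : KVec K (n + 1)}
    (hx : x (chartIndex p) ≠ 0) (y : KVec K (n + 1)) :
    mfderiv 𝓘(ℝ, KVec K n) 𝓘(ℝ, KVec K n) (chartAt (KVec K n) p) (toProj x)
      (mfderiv 𝓘(ℝ, KVec K (n + 1)) 𝓘(ℝ, KVec K n) toProj x y) =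
    affineDeriv (chartIndex p) x y := by
  have hx0 := ne_zero_of_coord hx
  have hs : toProj x ∈ (chartAt (KVec K n) p).source :=
    (toProj_mem_affineChart_source (chartIndex p) hx0).2 hx
  have h1 : MDifferentiableAt 𝓘(ℝ, KVec K n) 𝓘(ℝ, KVec K n) (chartAt (KVec K n) p) (toProj x) :=
    (contMDiffAt_of_mem_maximalAtlas (n := ∞) (IsManifold.chart_mem_maximalAtlas p)
      hs).mdifferentiableAt (by simp)
  have h2 := (contMDiffAt_toProj hx0).mdifferentiableAt (by simp)
  have h3 := mfderiv_comp x h1 h2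
  have h4 : (chartAt (KVec K n) p ∘ toProj : KVec K (n + 1) → KVec K n) =ᶠ[nhds x]
      affineCoord (chartIndex p) := by
    filter_upwards [isOpen_compl_singleton.mem_nhds (show x ∈ ({0} : Set _)ᶜ from hx0)] with y hy
    exact affineChart_toProj _ hy
  rw [h4.mfderiv_eq, mfderiv_eq_fderiv] at h3
  rw [← fderiv_affineCoord_apply _ hx, h3]
  rfl

/-- The differential of `π`, a vector of the tangent space at `π x` being by definition the vector of
its coordinates in the preferred chart at `π x`. -/
lemma mfderiv_toProj {x : KVec K (n + 1)} (hx : x ≠ 0) (y : KVec K (n + 1)) :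
    (mfderiv 𝓘(ℝ, KVec K (n + 1)) 𝓘(ℝ, KVec K n) toProj x y : KVec K n) =
      affineDeriv (chartIndex (toProj x)) x y := by
  have hs : x (chartIndex (toProj x)) ≠ 0 :=
    (toProj_mem_affineChart_source _ hx).1 (mem_chart_source (KVec K n) (toProj x))
  rw [← fderiv_affineCoord_apply _ hs,
    ((contMDiffAt_toProj hx).mdifferentiableAt (by simp)).mfderiv]
  simp only [writtenInExtChartAt, mfld_simps, fderivWithin_univ]
  have h4 : (chartAt (KVec K n) (toProj x) ∘ toProj : KVec K (n + 1) → KVec K n) =ᶠ[nhds x]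
      affineCoord (chartIndex (toProj x)) := by
    filter_upwards [isOpen_compl_singleton.mem_nhds (show x ∈ ({0} : Set _)ᶜ from hx)] with y hy
    exact affineChart_toProj _ hy
  exact congrArg (fun L : KVec K (n + 1) →L[ℝ] KVec K n => L y) h4.fderiv_eq

/-- The tangent vector `t d π_x (y)` of `K P ^ n` at `π x`, where `x ≠ 0`. -/
def projTangent (t : ℝ) (x y : KVec K (n + 1)) : TangentBundle 𝓘(ℝ, KVec K n) (KProj K n) :=
  ⟨toProj x, t • mfderiv 𝓘(ℝ, KVec K (n + 1)) 𝓘(ℝ, KVec K n) toProj x y⟩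

lemma projTangent_smul_smul (t : ℝ) {q : K} (hq : q ≠ 0) {x : KVec K (n + 1)} (hx : x ≠ 0)
    (y : KVec K (n + 1)) : projTangent t (q • x) (q • y) = projTangent t x y := by
  refine tangentBundle_mk_congr (toProj_smul hq hx) ?_
  have h1 := mfderiv_toProj (smul_ne_zero hq hx) (q • y)
  rw [toProj_smul hq hx, affineDeriv_smul_smul _ hq, ← mfderiv_toProj hx y] at h1
  exact congrArg (t • ·) h1

lemma tangentChart_projTangent (t : ℝ) (p : KProj K n) {x : KVec K (n + 1)}
    (hx : x (chartIndex p) ≠ 0) (y : KVec K (n + 1)) :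
    tangentChart p (projTangent t x y) =
      (affineCoord (chartIndex p) x, t • affineDeriv (chartIndex p) x y) := by
  have hx0 := ne_zero_of_coord hx
  have hs : toProj x ∈ (chartAt (KVec K n) p).source :=
    (toProj_mem_affineChart_source (chartIndex p) hx0).2 hx
  refine (tangentChart_mk p (toProj x) hs _).trans (Prod.ext (affineChart_toProj _ hx0) ?_)
  refine (map_smul (mfderiv 𝓘(ℝ, KVec K n) 𝓘(ℝ, KVec K n) (chartAt (KVec K n) p) (toProj x)) t
    _).trans ?_
  exact congrArg (t • ·) (mfderiv_affineChart_mfderiv_toProj p hx y)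

/-- On the `K`-orthogonal complement of a unit vector `x`, the differential `d π_x` is isometric for
the Fubini-Study metric `g`; the lengths here are those of `c • g`. -/
lemma normSq_projTangent {c : ℝ} (hc : 0 < c) (t : ℝ) {x y : KVec K (n + 1)} (hx : ‖x‖ = 1)
    (hxy : hermProd x y = 0) :
    (fubiniStudy hc).normSq (projTangent t x y) = t ^ 2 * c * ‖y‖ ^ 2 := by
  have hx0 : x ≠ 0 := norm_ne_zero_iff.1 (by simp [hx])
  have hs : x (chartIndex (toProj x)) ≠ 0 :=
    (toProj_mem_affineChart_source _ hx0).1 (mem_chart_source (KVec K n) (toProj x))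
  have hyx : hermProd y x = 0 := by rw [← star_hermProd, hxy, star_zero]
  have h0 : (fubiniStudy hc).normSq (projTangent 1 x y) = c * ‖y‖ ^ 2 := by
    have h1 : (fubiniStudy hc).normSq (projTangent 1 x y) =
        c * affineForm (chartIndex (toProj x)) (affineCoord (chartIndex (toProj x)) x)
          (affineDeriv (chartIndex (toProj x)) x y) (affineDeriv (chartIndex (toProj x)) x y) := by
      rw [← affineChart_toProj _ hx0, ← mfderiv_toProj hx0 y]
      refine Eq.trans ?_ (fubiniStudyInner_apply c (toProj x) _ _)
      unfold RiemMetric.normSq projTangent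
      rw [one_smul]
      rfl
    rw [h1, affineForm_apply, insertCoord_affineCoord _ hs, insertCoord_affineDeriv _ hs,
      horizontalForm_invariant hx0 (inv_ne_zero hs), horizontalForm_apply, horizontalPart_apply,
      hyx, hx]
    simp
  have h2 : projTangent t x y = tangentSMul t (projTangent 1 x y) := by
    unfold projTangent tangentSMul
    rw [one_smul]
  rw [h2, normSq_tangentSMul, h0, mul_assoc]

variable {c r : ℝ} (hc : 0 < c) (hr : 0 < r)

/-- The map `[x, y] ↦ (r / √c) d π_x (y)` from `W_2(K ^ (n + 1))` to `T_r K P ^ n`. -/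
def projStiefelToTangent (w : ProjStiefel K (n + 1)) :
    TangentSphereBundle (fubiniStudy (K := K) (n := n) hc) hr :=
  Quotient.lift (s := MulAction.orbitRel (Metric.sphere (0 : K) 1) (Stiefel K (n + 1)))
    (fun f => (⟨projTangent (r / √c) f.1.1 f.1.2, by
      rw [normSq_projTangent hc _ f.2.1 f.2.2.2, f.2.2.1, div_pow, Real.sq_sqrt hc.le]
      field_simp⟩ : TangentSphereBundle (fubiniStudy (K := K) (n := n) hc) hr)) (by
    rintro _ f ⟨q, rfl⟩
    exact Subtype.ext (projTangent_smul_smul _ (ne_zero_of_mem_unit_sphere q) f.fst_ne_zero _)) w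

lemma projStiefelToTangent_mk (f : Stiefel K (n + 1)) :
    (projStiefelToTangent hc hr (ProjStiefel.mk f)).1 = projTangent (r / √c) f.1.1 f.1.2 := rfl

/-! ### The change of fibre coordinates -/

/-- The inverse `v ↦ v - (1 + ‖z‖ ^ 2)⁻¹ ⟨v, z⟩ z` of `hermShear z`. -/
def hermUnshear (z v : KVec K n) : KVec K n := v - (1 + ‖z‖ ^ 2)⁻¹ • (hermProd v z • z)

lemma hermProd_real_smul_left (t : ℝ) (x z : KVec K n) :
    hermProd (t • x) z = t • hermProd x z := by
  simpa using hermProd_real_smul_smul t 1 x z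

lemma hermShear_smul (t : ℝ) (z v : KVec K n) : hermShear z (t • v) = t • hermShear z v := by
  rw [hermShear, hermProd_real_smul_left, smul_assoc, hermShear, smul_add]

lemma hermUnshear_smul (t : ℝ) (z v : KVec K n) :
    hermUnshear z (t • v) = t • hermUnshear z v := by
  rw [hermUnshear, hermProd_real_smul_left, smul_assoc, hermUnshear, smul_sub,
    smul_comm t (1 + ‖z‖ ^ 2)⁻¹]

lemma hermProd_smul_self (z v : KVec K n) :
    hermProd (hermProd v z • z) z = (‖z‖ ^ 2) • hermProd v z := by
  rw [hermProd_smul_left, hermProd_self, HermitianScalars.mul_smul, mul_one]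

lemma hermUnshear_hermShear (z v : KVec K n) : hermUnshear z (hermShear z v) = v := by
  have h0 : (1 + ‖z‖ ^ 2 : ℝ) ≠ 0 := by positivity
  have h : hermProd (hermShear z v) z = (1 + ‖z‖ ^ 2) • hermProd v z := by
    rw [hermShear, hermProd_add_left, hermProd_smul_self, add_smul, one_smul]
  rw [hermUnshear, h, smul_assoc, smul_smul, inv_mul_cancel₀ h0, one_smul, hermShear,
    add_sub_cancel_right]

lemma hermShear_hermUnshear (z v : KVec K n) : hermShear z (hermUnshear z v) = v := by
  have h0 : (1 + ‖z‖ ^ 2 : ℝ) ≠ 0 := by positivity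
  have h : hermProd (hermUnshear z v) z = (1 + ‖z‖ ^ 2)⁻¹ • hermProd v z := by
    have h1 : hermUnshear z v + (1 + ‖z‖ ^ 2)⁻¹ • (hermProd v z • z) = v := sub_add_cancel _ _
    have h2 := congrArg (hermProd · z) h1
    simp only [hermProd_add_left, hermProd_real_smul_left, hermProd_smul_self] at h2
    rw [← eq_sub_iff_add_eq] at h2
    rw [h2, smul_smul]
    nth_rewrite 1 [← one_smul ℝ (hermProd v z)]
    rw [← sub_smul]
    congr 1
    field_simp
    ring
  rw [hermShear, h, smul_assoc, hermUnshear, sub_add_cancel]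

lemma hermShear_ne_zero (z : KVec K n) {v : KVec K n} (hv : v ≠ 0) : hermShear z v ≠ 0 := by
  intro h
  have h1 := hermUnshear_hermShear z v
  rw [h, show hermUnshear z (0 : KVec K n) = 0 by simp [hermUnshear, hermProd]] at h1
  exact hv h1.symm

lemma hermUnshear_ne_zero (z : KVec K n) {v : KVec K n} (hv : v ≠ 0) : hermUnshear z v ≠ 0 := by
  intro h
  have h1 := hermShear_hermUnshear z v
  rw [h, show hermShear z (0 : KVec K n) = 0 by simp [hermShear, hermProd]] at h1
  exact hv h1.symm

lemma contDiff_hermProd_smul :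
    ContDiff ℝ ∞ (fun q : KVec K n × KVec K n => hermProd q.2 q.1 • q.1) :=
  contDiff_iff_contDiffAt.2 fun _ =>
    (ContDiffAt.hermProd contDiffAt_snd contDiffAt_fst).kvecSMul contDiffAt_fst

variable [NeZero n]

/-- The diffeomorphism `(z, s) ↦ (z, A_z s / ‖A_z s‖)` of `K ^ n × S(K ^ n)`, where
`A_z = hermShear z`. -/
def shearDir (p : KVec K n × Metric.sphere (0 : KVec K n) 1) :
    KVec K n × Metric.sphere (0 : KVec K n) 1 :=
  (p.1, unitDir (hermShear p.1 p.2))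

/-- The inverse of `shearDir`. -/
def unshearDir (p : KVec K n × Metric.sphere (0 : KVec K n) 1) :
    KVec K n × Metric.sphere (0 : KVec K n) 1 :=
  (p.1, unitDir (hermUnshear p.1 p.2))

lemma unitDir_hermShear_unitDir (z : KVec K n) {v : KVec K n} (hv : v ≠ 0) :
    unitDir (hermShear z (unitDir v)) = unitDir (hermShear z v) := by
  rw [coe_unitDir hv, hermShear_smul, unitDir_smul (inv_pos.2 (norm_pos_iff.2 hv))]

lemma unitDir_hermUnshear_unitDir (z : KVec K n) {v : KVec K n} (hv : v ≠ 0) :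
    unitDir (hermUnshear z (unitDir v)) = unitDir (hermUnshear z v) := by
  rw [coe_unitDir hv, hermUnshear_smul, unitDir_smul (inv_pos.2 (norm_pos_iff.2 hv))]

lemma unshearDir_shearDir (p : KVec K n × Metric.sphere (0 : KVec K n) 1) :
    unshearDir (shearDir p) = p := by
  refine Prod.ext rfl ?_
  refine (unitDir_hermUnshear_unitDir p.1
    (hermShear_ne_zero p.1 (ne_zero_of_mem_unit_sphere p.2))).trans ?_
  rw [hermUnshear_hermShear, unitDir_coe]

lemma shearDir_unshearDir (p : KVec K n × Metric.sphere (0 : KVec K n) 1) :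
    shearDir (unshearDir p) = p := by
  refine Prod.ext rfl ?_
  refine (unitDir_hermShear_unitDir p.1
    (hermUnshear_ne_zero p.1 (ne_zero_of_mem_unit_sphere p.2))).trans ?_
  rw [hermShear_hermUnshear, unitDir_coe]

/-- A smooth family of maps `F z` without zeros on the unit sphere acts smoothly on directions:
`(z, s) ↦ (z, F z s / ‖F z s‖)` is smooth. -/
lemma contMDiff_unitDir_family {F : KVec K n × KVec K n → KVec K n} (hF : ContDiff ℝ ∞ F)
    (hF0 : ∀ p : KVec K n × Metric.sphere (0 : KVec K n) 1, F (p.1, p.2) ≠ 0) :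
    ContMDiff (𝓘(ℝ, KVec K n).prod 𝓘(ℝ, SphereModel (KVec K n)))
      (𝓘(ℝ, KVec K n).prod 𝓘(ℝ, SphereModel (KVec K n))) ∞
      (fun p : KVec K n × Metric.sphere (0 : KVec K n) 1 =>
        (p.1, unitDir (F (p.1, (p.2 : KVec K n))))) := by
  have hG : ContMDiff (𝓘(ℝ, KVec K n).prod 𝓘(ℝ, SphereModel (KVec K n)))
      𝓘(ℝ, KVec K n × KVec K n) ∞
      (fun p : KVec K n × Metric.sphere (0 : KVec K n) 1 => (p.1, (p.2 : KVec K n))) :=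
    contMDiff_fst.prodMk_space (contMDiff_coe_sphere.comp contMDiff_snd)
  intro p
  exact contMDiffAt_fst.prodMk
    (ContMDiffAt.comp p (contMDiffAt_unitDir (hF0 p)) (hF.contMDiff.comp hG p))

lemma contMDiff_shearDir :
    ContMDiff (𝓘(ℝ, KVec K n).prod 𝓘(ℝ, SphereModel (KVec K n)))
      (𝓘(ℝ, KVec K n).prod 𝓘(ℝ, SphereModel (KVec K n))) ∞ (shearDir (K := K) (n := n)) :=
  contMDiff_unitDir_family (F := fun q => hermShear q.1 q.2)
    (contDiff_snd.add contDiff_hermProd_smul)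
    fun p => hermShear_ne_zero p.1 (ne_zero_of_mem_unit_sphere p.2)

lemma contMDiff_unshearDir :
    ContMDiff (𝓘(ℝ, KVec K n).prod 𝓘(ℝ, SphereModel (KVec K n)))
      (𝓘(ℝ, KVec K n).prod 𝓘(ℝ, SphereModel (KVec K n))) ∞ (unshearDir (K := K) (n := n)) := by
  have h : ContDiff ℝ ∞ (fun q : KVec K n × KVec K n => (1 + ‖q.1‖ ^ 2)⁻¹) :=
    (contDiff_const.add (contDiff_fst.norm_sq ℝ)).inv fun q => by positivity
  exact contMDiff_unitDir_family (F := fun q => hermUnshear q.1 q.2)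
    (contDiff_snd.sub (h.smul contDiff_hermProd_smul))
    fun p => hermUnshear_ne_zero p.1 (ne_zero_of_mem_unit_sphere p.2)

lemma tangentDir_projTangent {t : ℝ} (ht : 0 < t) (p : KProj K n) {f : Stiefel K (n + 1)}
    (hf : f.1.1 (chartIndex p) ≠ 0) :
    tangentDir p (projTangent t f.1.1 f.1.2) = shearDir (stiefelCoord (chartIndex p) f.1) := by
  unfold tangentDir
  rw [tangentChart_projTangent t p hf, unitDir_smul ht, affineDeriv_eq_hermShear _ hf f.2.2.2,
    ← unitDir_hermShear_unitDir _ (dropCoord_ne_zero _ hf)]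
  rfl

/-! ### The diffeomorphism -/

lemma projStiefelToTangent_mem_source (p : KProj K n) (w : ProjStiefel K (n + 1)) :
    projStiefelToTangent hc hr w ∈ (tangentSphereChart (fubiniStudy hc) hr p).source ↔
      w ∈ (stiefelChart (chartIndex p)).source := by
  obtain ⟨f⟩ := w
  exact toProj_mem_affineChart_source _ f.fst_ne_zero

/-- In the charts of `W_2(K ^ (n + 1))` and of `T_r K P ^ n`, the map is `shearDir`. -/
lemma tangentSphereChart_projStiefelToTangent (p : KProj K n) {w : ProjStiefel K (n + 1)}
    (hw : w ∈ (stiefelChart (chartIndex p)).source) :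
    tangentSphereChart (fubiniStudy hc) hr p (projStiefelToTangent hc hr w) =
      shearDir (stiefelChart (chartIndex p) w) := by
  obtain ⟨f⟩ := w
  exact tangentDir_projTangent (div_pos hr (Real.sqrt_pos.2 hc)) p hw

lemma projStiefelToTangent_eq (p : KProj K n) {w : ProjStiefel K (n + 1)}
    (hw : w ∈ (stiefelChart (chartIndex p)).source) :
    projStiefelToTangent hc hr w = (tangentSphereChart (fubiniStudy hc) hr p).symm
      (shearDir (stiefelChart (chartIndex p) w)) := by
  rw [← tangentSphereChart_projStiefelToTangent hc hr p hw, OpenPartialHomeomorph.left_inv]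
  exact (projStiefelToTangent_mem_source hc hr p w).2 hw

/-- The inverse of `projStiefelToTangent`, computed in the preferred chart at the base point. -/
def tangentToProjStiefel (u : TangentSphereBundle (fubiniStudy (K := K) (n := n) hc) hr) :
    ProjStiefel K (n + 1) :=
  (stiefelChart (chartIndex u.1.proj)).symm
    (unshearDir (tangentSphereChart (fubiniStudy hc) hr u.1.proj u))

lemma tangentToProjStiefel_projStiefelToTangent (w : ProjStiefel K (n + 1)) :
    tangentToProjStiefel hc hr (projStiefelToTangent hc hr w) = w := by
  have hw := (projStiefelToTangent_mem_source hc hr (projStiefelToTangent hc hr w).1.proj w).1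
    (mem_chart_source (KVec K n) (projStiefelToTangent hc hr w).1.proj)
  rw [tangentToProjStiefel, tangentSphereChart_projStiefelToTangent hc hr _ hw,
    unshearDir_shearDir, OpenPartialHomeomorph.left_inv _ hw]

/-- The formula defining `tangentToProjStiefel` gives a preimage of `u` in every chart around the
base point of `u`; as the map is injective, the formula does not depend on the chart. -/
lemma projStiefelToTangent_symm_unshearDir (p : KProj K n)
    {u : TangentSphereBundle (fubiniStudy (K := K) (n := n) hc) hr}
    (hu : u ∈ (tangentSphereChart (fubiniStudy hc) hr p).source) :
    projStiefelToTangent hc hr ((stiefelChart (chartIndex p)).symm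
      (unshearDir (tangentSphereChart (fubiniStudy hc) hr p u))) = u := by
  have hq : unshearDir (tangentSphereChart (fubiniStudy hc) hr p u) ∈
    (stiefelChart (K := K) (chartIndex p)).target := trivial
  rw [projStiefelToTangent_eq hc hr p (OpenPartialHomeomorph.map_target _ hq),
    OpenPartialHomeomorph.right_inv _ hq, shearDir_unshearDir,
    OpenPartialHomeomorph.left_inv _ hu]

lemma projStiefelToTangent_tangentToProjStiefel
    (u : TangentSphereBundle (fubiniStudy (K := K) (n := n) hc) hr) :
    projStiefelToTangent hc hr (tangentToProjStiefel hc hr u) = u :=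
  projStiefelToTangent_symm_unshearDir hc hr _ (mem_chart_source (KVec K n) u.1.proj)

lemma tangentToProjStiefel_eq (p : KProj K n)
    {u : TangentSphereBundle (fubiniStudy (K := K) (n := n) hc) hr}
    (hu : u ∈ (tangentSphereChart (fubiniStudy hc) hr p).source) :
    tangentToProjStiefel hc hr u = (stiefelChart (chartIndex p)).symm
      (unshearDir (tangentSphereChart (fubiniStudy hc) hr p u)) := by
  conv_lhs => rw [← projStiefelToTangent_symm_unshearDir hc hr p hu]
  exact tangentToProjStiefel_projStiefelToTangent hc hr _

lemma contMDiff_projStiefelToTangent :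
    ContMDiff (𝓘(ℝ, KVec K n).prod 𝓘(ℝ, SphereModel (KVec K n)))
      (𝓘(ℝ, KVec K n).prod 𝓘(ℝ, SphereModel (KVec K n))) ∞
      (projStiefelToTangent (K := K) (n := n) hc hr) := by
  intro w
  set p := (projStiefelToTangent hc hr w).1.proj
  have hw : w ∈ (stiefelChart (chartIndex p)).source :=
    (projStiefelToTangent_mem_source hc hr p w).1 (mem_chart_source (KVec K n) p)
  have hs := (stiefelChart (chartIndex p)).open_source.mem_nhds hw
  -- affine charts are onto `K ^ n`, so that the charts of `T_r K P ^ n` are onto as well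
  have ht : shearDir (stiefelChart (chartIndex p) w) ∈
      (tangentSphereChart (fubiniStudy hc) hr p).target :=
    ⟨trivial, trivial⟩
  have h1 := (contMDiffOn_stiefelChart (chartIndex p)).contMDiffAt hs
  have h2 := (contMDiffOn_tangentSphereChart_symm (fubiniStudy hc) hr p).contMDiffAt
    ((tangentSphereChart (fubiniStudy hc) hr p).open_target.mem_nhds ht)
  refine (h2.comp w ((contMDiff_shearDir _).comp w h1)).congr_of_eventuallyEq ?_
  filter_upwards [hs] with w' hw'
  exact projStiefelToTangent_eq hc hr p hw'

lemma contMDiff_tangentToProjStiefel :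
    ContMDiff (𝓘(ℝ, KVec K n).prod 𝓘(ℝ, SphereModel (KVec K n)))
      (𝓘(ℝ, KVec K n).prod 𝓘(ℝ, SphereModel (KVec K n))) ∞
      (tangentToProjStiefel (K := K) (n := n) hc hr) := by
  intro u
  have hu : u ∈ (tangentSphereChart (fubiniStudy hc) hr u.1.proj).source :=
    mem_chart_source (KVec K n) u.1.proj
  have hs := (tangentSphereChart (fubiniStudy hc) hr u.1.proj).open_source.mem_nhds hu
  have h1 := (contMDiffOn_tangentSphereChart (fubiniStudy hc) hr u.1.proj).contMDiffAt hs
  have h2 := (contMDiffOn_stiefelChart_symm (K := K) (chartIndex u.1.proj)).contMDiffAt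
    (x := unshearDir (tangentSphereChart (fubiniStudy hc) hr u.1.proj u))
    ((stiefelChart (chartIndex u.1.proj)).open_target.mem_nhds trivial)
  refine (h2.comp u ((contMDiff_unshearDir _).comp u h1)).congr_of_eventuallyEq ?_
  filter_upwards [hs] with u' hu'
  exact tangentToProjStiefel_eq hc hr u.1.proj hu'

/-- The diffeomorphism `T_r K P ^ n → W_2(K ^ (n + 1))`, for all three division rings at once. -/
def tangentSphereDiffeomorph : TangentSphereBundle (fubiniStudy (K := K) (n := n) hc) hr
    ≃ₘ⟮𝓘(ℝ, KVec K n).prod 𝓘(ℝ, SphereModel (KVec K n)),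
      𝓘(ℝ, KVec K n).prod 𝓘(ℝ, SphereModel (KVec K n))⟯ ProjStiefel K (n + 1) where
  toFun := tangentToProjStiefel hc hr
  invFun := projStiefelToTangent hc hr
  left_inv := projStiefelToTangent_tangentToProjStiefel hc hr
  right_inv := tangentToProjStiefel_projStiefelToTangent hc hr
  contMDiff_toFun := contMDiff_tangentToProjStiefel hc hr
  contMDiff_invFun := contMDiff_projStiefelToTangent hc hr

end ProjectiveSpace

end

theorem mainTheorem5 (n : ℕ) [NeZero n] {c r : ℝ} (hc : 0 < c) (hr : 0 < r) :
    (∃ Φ : TangentSphereBundle (fubiniStudy (K := ℝ) (n := n) hc) hr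
          ≃ₘ⟮𝓘(ℝ, KVec ℝ n).prod 𝓘(ℝ, SphereModel (KVec ℝ n)),
            𝓘(ℝ, KVec ℝ n).prod 𝓘(ℝ, SphereModel (KVec ℝ n))⟯ ProjStiefel ℝ (n + 1),
        ∀ f : Stiefel ℝ (n + 1), (Φ.symm (ProjStiefel.mk f)).1 =
          ⟨toProj f.1.1, (r / √c) •
            mfderiv 𝓘(ℝ, KVec ℝ (n + 1)) 𝓘(ℝ, KVec ℝ n) toProj f.1.1 f.1.2⟩) ∧
    (∃ Φ : TangentSphereBundle (fubiniStudy (K := ℂ) (n := n) hc) hr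
          ≃ₘ⟮𝓘(ℝ, KVec ℂ n).prod 𝓘(ℝ, SphereModel (KVec ℂ n)),
            𝓘(ℝ, KVec ℂ n).prod 𝓘(ℝ, SphereModel (KVec ℂ n))⟯ ProjStiefel ℂ (n + 1),
        ∀ f : Stiefel ℂ (n + 1), (Φ.symm (ProjStiefel.mk f)).1 =
          ⟨toProj f.1.1, (r / √c) •
            mfderiv 𝓘(ℝ, KVec ℂ (n + 1)) 𝓘(ℝ, KVec ℂ n) toProj f.1.1 f.1.2⟩) ∧
    (∃ Φ : TangentSphereBundle (fubiniStudy (K := ℍ[ℝ]) (n := n) hc) hr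
          ≃ₘ⟮𝓘(ℝ, KVec ℍ[ℝ] n).prod 𝓘(ℝ, SphereModel (KVec ℍ[ℝ] n)),
            𝓘(ℝ, KVec ℍ[ℝ] n).prod 𝓘(ℝ, SphereModel (KVec ℍ[ℝ] n))⟯ ProjStiefel ℍ[ℝ] (n + 1),
        ∀ f : Stiefel ℍ[ℝ] (n + 1), (Φ.symm (ProjStiefel.mk f)).1 =
          ⟨toProj f.1.1, (r / √c) •
            mfderiv 𝓘(ℝ, KVec ℍ[ℝ] (n + 1)) 𝓘(ℝ, KVec ℍ[ℝ] n) toProj f.1.1 f.1.2⟩) := by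
  exact ⟨⟨tangentSphereDiffeomorph hc hr, projStiefelToTangent_mk hc hr⟩,
    ⟨tangentSphereDiffeomorph hc hr, projStiefelToTangent_mk hc hr⟩,
    ⟨tangentSphereDiffeomorph hc hr, projStiefelToTangent_mk hc hr⟩⟩
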